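/- Let $G$ be a locally compact second countable topological group with identity $e$. A function $\phi:G\to\mathbb{C}$ is called positive definite if for all $n$, all $c_1,\dots,c_n\in\mathbb{C}$ and all $g_1,\dots,g_n\in G$ the sum $\sum_{i,j=1}^n c_i\overline{c_j}\,\phi(g_ig_j^{-1})$ is a nonnegative real number. A measure preserving system $(X,\mathscr{B},\mu,(T_g)_{g\in G})$ is a probability space $(X,\mathscr{B},\mu)$ with an action $T$ of $G$ on $X$ by measurable maps such that $\mu(T_gA)=\mu(A)$ for all $g\in G$ and $A\in\mathscr{B}$, and $\lim_{g\to e}\mu(T_gA\,\triangle\,A)=0$ for all $A\in\mathscr{B}$. It is ergodic if every $A\in\mathscr{B}$ with $\mu(T_gA\,\triangle\,A)=0$ for all $g\in G$ satisfies $\mu(A)\in\{0,1\}$. For $f\in L^2(X,\mu)$ (complex-valued) put $(T_gf)(x)=f(T_{g^{-1}}x)$, and let $\langle u,v\rangle=\int_X u\,\overline{v}\,d\mu$. Theorem. For every continuous positive definite function $\phi:G\to\mathbb{C}$ there exist an ergodic measure preserving system $(X,\mathscr{B},\mu,(T_g)_{g\in G})$ and $f\in L^2(X,\mu)$ such that $\phi(g)=\langle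 T_gf,f\rangle$ for all $g\in G$. Furthermore, if $\phi$ is real-valued, then $f$ can also be taken to be real-valued. -/

import Mathlib

open MeasureTheory Filter Topology
open scoped ComplexConjugate symmDiff Pointwise

universe u v

open scoped ComplexOrder in
/-- A function `φ : G → ℂ` on a group is positive definite if every sum
`∑ i, ∑ j, c i * conj (c j) * φ (g i * (g j)⁻¹)` is a nonnegative real number
(`0 ≤ z` for complex `z` means that `z` is real and nonnegative). -/
def IsPositiveDefiniteFun {G : Type u} [Group G] (φ : G → ℂ) : Prop :=
  ∀ (n : ℕ) (c : Fin n → ℂ) (g : Fin n → G),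
    0 ≤ ∑ i, ∑ j, c i * conj (c j) * φ (g i * (g j)⁻¹)

/-- A measure preserving system of a topological group `G`: a probability space `(X, μ)` with an
action of `G` on `X` by measurable maps that preserve `μ`, such that `μ (gA ∆ A) → 0` as `g → 1`
for every measurable set `A`. -/
structure MeasurePreservingSystem (G : Type u) [Group G] [TopologicalSpace G] where
  X : Type v
  [measurableSpace : MeasurableSpace X]
  [mulAction : MulAction G X]
  μ : Measure X
  [isProbabilityMeasure : IsProbabilityMeasure μ]
  [measurableConstSMul : MeasurableConstSMul G X]
  [smulInvariantMeasure : SMulInvariantMeasure G X μ]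
  tendsto_measure_symmDiff : ∀ A : Set X, MeasurableSet A →
    Tendsto (fun g : G => μ ((g • A) ∆ A)) (𝓝 1) (𝓝 0)

namespace MeasurePreservingSystem

attribute [instance] measurableSpace mulAction isProbabilityMeasure measurableConstSMul
  smulInvariantMeasure

variable {G : Type u} [Group G] [TopologicalSpace G]

/-- Ergodicity: a measurable set that is invariant mod `μ` under every `g : G` is null or
conull. -/
def IsErgodic (S : MeasurePreservingSystem.{u, v} G) : Prop :=
  ErgodicSMul G S.X S.μ

/-- The Koopman representation of `G` on `L²(X, μ)`: `(T_g f)(x) = f (g⁻¹ • x)`.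
Mathlib's `inner ℂ a b` is linear in `b`, so the inner product `⟨T_g f, f⟩ = ∫ T_g f * conj f ∂μ`,
linear in its first entry, is written `inner ℂ f (S.koopman g f)`. -/
noncomputable def koopman (S : MeasurePreservingSystem.{u, v} G) (g : G) (f : Lp ℂ 2 S.μ) :
    Lp ℂ 2 S.μ :=
  DomMulAct.mk g⁻¹ • f

/-- The defining formula of the Koopman representation. -/
theorem koopman_ae_eq (S : MeasurePreservingSystem.{u, v} G) (g : G) (f : Lp ℂ 2 S.μ) :
    S.koopman g f =ᵐ[S.μ] fun x => f (g⁻¹ • x) :=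
  DomMulAct.smul_Lp_ae_eq _ f

end MeasurePreservingSystem

/-! By the GNS construction, φ is a diagonal coefficient of a continuous unitary representation ρ of
G on a Hilbert space H, at a cyclic vector v. The weak operator closure of ρ(G) is a compact
semigroup of contractions, and a minimal idempotent P of it is an orthogonal projection commuting
with ρ (`exists_compact_part`, the de Leeuw–Glicksberg splitting). On the range of P, ρ factors
through a homomorphism κ with dense range into a compact group K. On the kernel of P, ρ(g) tends
weakly to 0 along some filter l on G. So φ is the coefficient at u = v - Pv plus the coefficient at
Pv.

Each summand has a natural model. For u it is the Gaussian process with the real covariance of the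
orbits of u and iu, on which G acts by shifting coordinates. For Pv it is K with Haar measure and
translation through κ; there the polar decomposition of the coefficient map H → L²(K) gives the
required function (`exists_regular_coefficient`). On the product of the two systems the sum of the
two functions has coefficient φ: the Gaussian summand has mean zero, so the cross terms vanish.

The product is ergodic (`ergodic_shiftTranslate`). The Gaussian shift is mixing along l, so an
invariant set A is independent of the Gaussian coordinate in the sense that the measure restricted
to A is γ × ν for a measure ν on K. Then ν is invariant under the dense subgroup κ(G), and its
support is null or conull.

If φ is real, the coefficient at Pv is real, being a limit of values of φ, and hence so is the one
at u. Both models then allow real functions. -/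

/-- Two families of vectors with the same Gram matrix, the first of which has dense span, are
related by a linear isometry. -/
theorem exists_clm_of_inner_eq {𝕜 ι H₁ H₂ : Type*} [RCLike 𝕜]
    [NormedAddCommGroup H₁] [InnerProductSpace 𝕜 H₁]
    [NormedAddCommGroup H₂] [InnerProductSpace 𝕜 H₂] [CompleteSpace H₂]
    (v : ι → H₁) (w : ι → H₂) (h : ∀ i j, inner 𝕜 (v i) (v j) = inner 𝕜 (w i) (w j))
    (hv : (Submodule.span 𝕜 (Set.range v)).topologicalClosure = ⊤) :
    ∃ U : H₁ →L[𝕜] H₂, (∀ i, U (v i) = w i) ∧ ∀ x y, inner 𝕜 (U x) (U y) = inner 𝕜 x y := by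
  let e : (ι →₀ 𝕜) →ₗ[𝕜] H₁ := Finsupp.linearCombination 𝕜 v
  let f : (ι →₀ 𝕜) →ₗ[𝕜] H₂ := Finsupp.linearCombination 𝕜 w
  have hinner (x y) : inner 𝕜 (f x) (f y) = inner 𝕜 (e x) (e y) := by
    simp only [e, f, Finsupp.linearCombination_apply, Finsupp.sum, sum_inner, inner_sum,
      inner_smul_left, inner_smul_right, h]
  have hnorm (x) : ‖f x‖ = ‖e x‖ := by
    rw [@norm_eq_sqrt_re_inner 𝕜, hinner, ← @norm_eq_sqrt_re_inner 𝕜]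
  have hd : DenseRange e := by
    have : Set.range e = (Submodule.span 𝕜 (Set.range v) : Set H₁) := by
      rw [← Finsupp.range_linearCombination]; rfl
    rw [DenseRange, this]
    rwa [Submodule.dense_iff_topologicalClosure_eq_top]
  have hb : ∃ C, ∀ x, ‖f x‖ ≤ C * ‖e x‖ := ⟨1, fun x => by rw [hnorm, one_mul]⟩
  have hU := LinearMap.extendOfNorm_eq hd hb
  refine ⟨f.extendOfNorm e, fun i => ?_, fun x y => ?_⟩
  · simpa [e, f] using hU (Finsupp.single i 1)
  · refine hd.induction_on₂ (p := fun x y => inner 𝕜 (f.extendOfNorm e x) (f.extendOfNorm e y)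
      = inner 𝕜 x y) ?_ (fun a b => ?_) x y
    · exact isClosed_eq (by fun_prop) (by fun_prop)
    · rw [hU, hU, hinner]

/-! ### Gaussian processes with prescribed covariance -/

open ProbabilityTheory

/-- The characteristic function of a product of standard Gaussian measures. -/
theorem integral_exp_infinitePi_gaussianReal {ι : Type*} (c : ι →₀ ℝ) :
    ∫ x, Complex.exp (Complex.I * (c.sum fun i a => a * x i : ℝ))
      ∂(Measure.infinitePi fun _ : ι => gaussianReal 0 1)
      = Real.exp (-(c.sum fun _ a => a ^ 2) / 2) := by
  classical
  have h1 : ∀ x : ι → ℝ, Complex.exp (Complex.I * (c.sum fun i a => a * x i : ℝ))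
      = (fun y : c.support → ℝ => ∏ i : c.support, Complex.exp (Complex.I * (c i * y i : ℝ)))
        (c.support.restrict x) := by
    intro x
    simp only
    rw [← Complex.exp_sum, ← Finset.mul_sum]
    congr 2
    rw [Finsupp.sum, ← Finset.sum_coe_sort]
    push_cast
    rfl
  refine (integral_congr_ae (ae_of_all _ h1)).trans ?_
  refine (integral_restrict_infinitePi (μ := fun _ : ι => gaussianReal 0 1)
    (f := fun y : c.support → ℝ => ∏ i : c.support, Complex.exp (Complex.I * (c i * y i : ℝ)))
    (Measurable.aestronglyMeasurable
      (Finset.measurable_fun_prod _ fun i _ => by fun_prop))).trans ?_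
  rw [integral_fintype_prod_eq_prod (fun (i : c.support) (y : ℝ) =>
      Complex.exp (Complex.I * (c i * y : ℝ)))]
  have h2 : ∀ a : ℝ, ∫ y, Complex.exp (Complex.I * (a * y : ℝ)) ∂(gaussianReal 0 1)
      = Complex.exp (-a ^ 2 / 2) := by
    intro a
    have := charFun_gaussianReal (μ := 0) (v := 1) a
    rw [charFun_apply_real] at this
    convert this using 3
    · push_cast; ring_nf
    · simp; ring_nf
  simp_rw [h2]
  rw [← Complex.exp_sum, Finset.sum_coe_sort c.support (fun i => -(c i : ℂ) ^ 2 / 2)]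
  rw [Finsupp.sum, Complex.ofReal_exp]
  congr 1
  push_cast
  rw [← Finset.sum_div, Finset.sum_neg_distrib]

theorem coeFn_finsuppSum_smul {ι Ω : Type*} [MeasurableSpace Ω] {P : Measure Ω}
    (F : ι → Lp ℝ 2 P) (c : ι →₀ ℝ) :
    ∀ᵐ x ∂P, (c.sum fun i a => a • F i) x = c.sum fun i a => a * F i x := by
  unfold Finsupp.sum
  induction c.support using Finset.cons_induction with
  | empty =>
    filter_upwards [Lp.coeFn_zero ℝ 2 P] with x hx
    simpa using hx
  | cons i s hi ih =>
    simp only [Finset.sum_cons]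
    filter_upwards [ih, Lp.coeFn_add (c i • F i) (∑ i ∈ s, c i • F i),
      Lp.coeFn_smul (c i) (F i)] with x h1 h2 h3
    rw [h2, Pi.add_apply, h1, h3, Pi.smul_apply, smul_eq_mul]

/-- The bound |exp(is) - exp(it)| ≤ |s - t| combines with the domination of the L¹ norm by the L²
norm on a probability space. It makes the characteristic function continuous on L², so that Gaussian
identities pass from a dense span to its closure. -/
theorem norm_integral_exp_sub_le {Ω : Type*} [MeasurableSpace Ω] {P : Measure Ω}
    [IsProbabilityMeasure P] (f g : Lp ℝ 2 P) :
    ‖∫ x, Complex.exp (Complex.I * (f x : ℝ)) ∂P - ∫ x, Complex.exp (Complex.I * (g x : ℝ)) ∂P‖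
      ≤ ‖f - g‖ := by
  have hm (f : Lp ℝ 2 P) : Integrable (fun x => Complex.exp (Complex.I * (f x : ℝ))) P := by
    have := (Lp.stronglyMeasurable f).measurable
    refine Integrable.of_bound (C := 1) (by fun_prop) (ae_of_all _ fun x => ?_)
    rw [mul_comm, Complex.norm_exp_ofReal_mul_I]
  have h2 : MemLp (fun x => f x - g x) 2 P := (Lp.memLp f).sub (Lp.memLp g)
  have hi : Integrable (fun x => f x - g x) P := h2.integrable (by norm_num)
  rw [← integral_sub (hm f) (hm g)]
  calc _ ≤ ∫ x, ‖f x - g x‖ ∂P := by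
        refine norm_integral_le_of_norm_le hi.norm (ae_of_all _ fun x => ?_)
        have : Complex.exp (Complex.I * (f x : ℝ)) - Complex.exp (Complex.I * (g x : ℝ))
          = Complex.exp (Complex.I * (g x : ℝ)) *
            (Complex.exp (Complex.I * (f x - g x : ℝ)) - 1) := by
          rw [mul_sub, ← Complex.exp_add]; push_cast; ring_nf
        rw [this, norm_mul, mul_comm Complex.I (g x : ℂ), Complex.norm_exp_ofReal_mul_I, one_mul]
        exact Real.norm_exp_I_mul_ofReal_sub_one_le
    _ = (eLpNorm (fun x => f x - g x) 1 P).toReal := by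
        rw [integral_norm_eq_lintegral_enorm h2.1, eLpNorm_one_eq_lintegral_enorm]
    _ ≤ ‖f - g‖ := by
        rw [Lp.norm_def]
        refine ENNReal.toReal_mono (Lp.eLpNorm_ne_top _) ?_
        rw [eLpNorm_congr_ae (Lp.coeFn_sub f g)]
        exact eLpNorm_le_eLpNorm_of_exponent_le (by norm_num) h2.1

/-- Existence of the isonormal Gaussian process: every family of vectors of a real Hilbert space
is the covariance of a centered Gaussian process with the same index set. -/
theorem exists_gaussian_measure {ι E : Type*} [NormedAddCommGroup E] [InnerProductSpace ℝ E]
    [CompleteSpace E] (j : ι → E) :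
    ∃ γ : Measure (ι → ℝ), IsProbabilityMeasure γ ∧ ∀ t : ι →₀ ℝ,
      ∫ x, Complex.exp (Complex.I * (t.sum fun a s => s * x a : ℝ)) ∂γ
        = Real.exp (-‖t.sum fun a s => s • j a‖ ^ 2 / 2) := by
  obtain ⟨w, b, -⟩ := exists_hilbertBasis ℝ E
  let P : Measure (w → ℝ) := Measure.infinitePi fun _ => gaussianReal 0 1
  have hlaw (i : w) : MeasurePreserving (fun x : w → ℝ => x i) P (gaussianReal 0 1) :=
    measurePreserving_eval_infinitePi _ i
  have hX (i : w) : MemLp (fun x : w → ℝ => x i) 2 P :=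
    (memLp_id_gaussianReal 2).comp_measurePreserving (hlaw i)
  have hmap (i : w) (f : ℝ → ℝ) (hf : Measurable f) :
      ∫ x, f (x i) ∂P = ∫ y, f y ∂(gaussianReal 0 1) := by
    rw [← (hlaw i).map_eq, integral_map (hlaw i).measurable.aemeasurable hf.aestronglyMeasurable]
  have hort : Orthonormal ℝ fun i => (hX i).toLp := by
    classical
    rw [orthonormal_iff_ite]
    intro i k
    have : inner ℝ (hX i).toLp (hX k).toLp = ∫ x, x i * x k ∂P := by
      rw [L2.inner_def]
      refine integral_congr_ae ?_
      filter_upwards [(hX i).coeFn_toLp, (hX k).coeFn_toLp] with x h1 h2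
      rw [h1, h2]
      simp [mul_comm]
    rw [this]
    split_ifs with hik
    · subst hik
      rw [hmap i (fun y => y * y) (by fun_prop)]
      have := variance_eq_integral (μ := gaussianReal 0 1) (X := fun x => x) (by fun_prop)
      rw [variance_fun_id_gaussianReal, integral_id_gaussianReal] at this
      simpa [sq] using this.symm
    · have hind : IndepFun (fun x : w → ℝ => x i) (fun x => x k) P :=
        (iIndepFun_infinitePi (P := fun _ : w => gaussianReal 0 1) (X := fun _ y => y)
          fun _ => measurable_id).indepFun hik
      rw [hind.integral_fun_mul_eq_mul_integral (hX i).1 (hX k).1,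
        hmap i (fun y => y) measurable_id]
      simp
  -- The coordinates of a product of standard Gaussians are orthonormal in L². Sending a Hilbert
  -- basis of E to them extends to an isometry W from E into L², and the joint law of the variables
  -- W (j a) is the measure sought.
  obtain ⟨W, hW, hWi⟩ := exists_clm_of_inner_eq (𝕜 := ℝ) b (fun i => (hX i).toLp)
    (by classical
        intro i k
        rw [orthonormal_iff_ite.1 b.orthonormal, orthonormal_iff_ite.1 hort]) b.dense_span
  have hWn (u) : ‖W u‖ = ‖u‖ := by
    rw [@norm_eq_sqrt_real_inner, hWi, ← norm_eq_sqrt_real_inner]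
  have hchar (u : E) : ∫ x, Complex.exp (Complex.I * (W u x : ℝ)) ∂P
      = Real.exp (-‖u‖ ^ 2 / 2) := by
    have hcont : Continuous fun u => ∫ x, Complex.exp (Complex.I * (W u x : ℝ)) ∂P := by
      refine (LipschitzWith.of_dist_le_mul (K := 1) fun u u' => ?_).continuous
      rw [dist_eq_norm, dist_eq_norm, NNReal.coe_one, one_mul, ← hWn, map_sub]
      exact norm_integral_exp_sub_le _ _
    have hu : u ∈ (Submodule.span ℝ (Set.range b)).topologicalClosure := by
      rw [b.dense_span]; trivial
    refine closure_minimal (t := {u | ∫ x, Complex.exp (Complex.I * (W u x : ℝ)) ∂P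
      = Real.exp (-‖u‖ ^ 2 / 2)}) (fun u hu => ?_) (isClosed_eq hcont (by fun_prop)) hu
    obtain ⟨c, rfl⟩ := Finsupp.mem_span_range_iff_exists_finsupp.1 hu
    have hae : ∀ᵐ x ∂P, W (c.sum fun i a => a • b i) x = c.sum fun i a => a * x i := by
      have h : ∀ᵐ x ∂P, ∀ i ∈ c.support, ((hX i).toLp _ : Lp ℝ 2 P) x = x i :=
        (Finset.eventually_all _).2 fun i _ => (hX i).coeFn_toLp
      filter_upwards [h, coeFn_finsuppSum_smul (fun i => (hX i).toLp _) c] with x h1 h2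
      rw [map_finsuppSum]
      simp_rw [map_smul, hW]
      rw [h2]
      exact Finset.sum_congr rfl fun i hi => congrArg (c i * ·) (h1 i hi)
    have hns : ‖c.sum fun i a => a • b i‖ ^ 2 = c.sum fun _ a => a ^ 2 := by
      rw [← real_inner_self_eq_norm_sq, ← Finsupp.linearCombination_apply,
        b.orthonormal.inner_finsupp_eq_sum_left]
      simp [sq, Finsupp.sum]
    simp only [Set.mem_ofPred_eq]
    rw [hns, ← integral_exp_infinitePi_gaussianReal]
    refine integral_congr_ae ?_
    filter_upwards [hae] with x hx
    rw [hx]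
  have hmeas : Measurable fun (x : w → ℝ) (a : ι) => W (j a) x :=
    measurable_pi_lambda _ fun a => (Lp.stronglyMeasurable _).measurable
  refine ⟨P.map fun x a => W (j a) x, Measure.isProbabilityMeasure_map hmeas.aemeasurable,
    fun t => ?_⟩
  rw [integral_map hmeas.aemeasurable, ← hchar]
  · refine integral_congr_ae ?_
    have : ∀ᵐ x ∂P, W (t.sum fun a s => s • j a) x = t.sum fun a s => s * W (j a) x := by
      rw [map_finsuppSum]
      simp_rw [map_smul]
      exact coeFn_finsuppSum_smul (fun a => W (j a)) t
    filter_upwards [this] with x hx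
    rw [hx]
  · refine Measurable.aestronglyMeasurable ?_
    unfold Finsupp.sum
    fun_prop

/-- Finite measures on `ι → ℝ` with the same characteristic function are equal. -/
theorem ext_of_integral_exp_finsuppSum {ι : Type*} {m₁ m₂ : Measure (ι → ℝ)} [IsFiniteMeasure m₁]
    [IsFiniteMeasure m₂]
    (h : ∀ t : ι →₀ ℝ, ∫ x, Complex.exp (Complex.I * (t.sum fun a s => s * x a : ℝ)) ∂m₁
      = ∫ x, Complex.exp (Complex.I * (t.sum fun a s => s * x a : ℝ)) ∂m₂) : m₁ = m₂ := by
  classical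
  refine IsProjectiveLimit.unique (P := fun I => m₁.map I.restrict) (fun _ => rfl) fun I => ?_
  refine Measure.ext_of_charFunDual (funext fun L => ?_)
  -- The coefficients of the functional L in the coordinates of I, extended by zero: finitely
  -- supported t test every finite-dimensional marginal.
  let t : ι →₀ ℝ := Finsupp.onFinset I
    (fun a => if h : a ∈ I then L (Pi.single ⟨a, h⟩ 1) else 0) (fun a ha => by
      by_contra hc; simp [hc] at ha)
  have key : ∀ x : ι → ℝ, L (I.restrict x) = t.sum fun a s => s * x a := by
    intro x
    rw [Finsupp.onFinset_sum _ (by simp), ← Finset.sum_coe_sort]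
    have := LinearMap.pi_apply_eq_sum_univ L.toLinearMap (I.restrict x)
    simp only [ContinuousLinearMap.coe_coe] at this
    rw [this]
    refine Finset.sum_congr rfl fun i _ => ?_
    simp only [Finset.coe_mem, dite_true, smul_eq_mul, Finset.restrict]
    rw [mul_comm]
    congr 3
    ext k
    simp [Pi.single_apply, eq_comm]
  rw [charFunDual_apply, charFunDual_apply, integral_map (by fun_prop)
    (Measurable.aestronglyMeasurable (by fun_prop)), integral_map (by fun_prop)
    (Measurable.aestronglyMeasurable (by fun_prop))]
  simp_rw [key]
  convert! (h t).symm using 4 <;> ring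

/-- Finite measures on `(ι → ℝ) × K` that agree on products of a character with the indicator
of a measurable set are equal. -/
theorem ext_of_setIntegral_exp_finsuppSum {ι K : Type*} [MeasurableSpace K]
    {m₁ m₂ : Measure ((ι → ℝ) × K)} [IsFiniteMeasure m₁] [IsFiniteMeasure m₂]
    (h : ∀ (t : ι →₀ ℝ) (B : Set K), MeasurableSet B →
      ∫ p in Prod.snd ⁻¹' B, Complex.exp (Complex.I * (t.sum fun a s => s * p.1 a : ℝ)) ∂m₁
      = ∫ p in Prod.snd ⁻¹' B, Complex.exp (Complex.I * (t.sum fun a s => s * p.1 a : ℝ)) ∂m₂) :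
    m₁ = m₂ := by
  have hB (B : Set K) (hB : MeasurableSet B) :
      (m₁.restrict (Prod.snd ⁻¹' B)).map Prod.fst = (m₂.restrict (Prod.snd ⁻¹' B)).map Prod.fst := by
    refine ext_of_integral_exp_finsuppSum fun t => ?_
    have hm : Measurable fun x : ι → ℝ =>
        Complex.exp (Complex.I * (t.sum fun a s => s * x a : ℝ)) := by
      unfold Finsupp.sum; fun_prop
    rw [integral_map (by fun_prop) hm.aestronglyMeasurable,
      integral_map (by fun_prop) hm.aestronglyMeasurable]
    exact h t B hB
  have hr (A : Set (ι → ℝ)) (B : Set K) (hA : MeasurableSet A) (hBm : MeasurableSet B) :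
      m₁ (A ×ˢ B) = m₂ (A ×ˢ B) := by
    have : _ = _ := congrArg (fun m => m A) (hB B hBm)
    rw [Measure.map_apply measurable_fst hA, Measure.map_apply measurable_fst hA,
      Measure.restrict_apply (measurable_fst hA), Measure.restrict_apply (measurable_fst hA)] at this
    exact this
  refine ext_of_generate_finite _ generateFrom_prod.symm isPiSystem_prod ?_ ?_
  · rintro _ ⟨A, hA, B, hB, rfl⟩
    exact hr A B hA hB
  · have := hr Set.univ Set.univ .univ .univ
    rwa [Set.univ_prod_univ] at this

/-- `γ` is the law of a centered Gaussian process with covariance `⟪j a, j b⟫`. -/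
def HasGaussianCov {ι E : Type*} [NormedAddCommGroup E] [InnerProductSpace ℝ E]
    (γ : Measure (ι → ℝ)) (j : ι → E) : Prop :=
  ∀ t : ι →₀ ℝ, ∫ x, Complex.exp (Complex.I * (t.sum fun a s => s * x a : ℝ)) ∂γ
    = Real.exp (-‖t.sum fun a s => s • j a‖ ^ 2 / 2)

namespace HasGaussianCov

variable {ι E : Type*} [NormedAddCommGroup E] [InnerProductSpace ℝ E]
  {γ : Measure (ι → ℝ)} [IsProbabilityMeasure γ] {j : ι → E}

/-- Applying the covariance hypothesis to all multiples r • t yields the whole characteristic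
function of a single linear form. -/
theorem map_finsuppSum (h : HasGaussianCov γ j) (t : ι →₀ ℝ) :
    γ.map (fun x => t.sum fun a s => s * x a)
      = gaussianReal 0 (‖t.sum fun a s => s • j a‖ ^ 2).toNNReal := by
  have hm : Measurable fun x : ι → ℝ => t.sum fun a s => s * x a := by
    unfold Finsupp.sum; fun_prop
  refine Measure.ext_of_charFun (funext fun r => ?_)
  rw [charFun_apply_real, charFun_gaussianReal, integral_map hm.aemeasurable
    (Measurable.aestronglyMeasurable (by fun_prop))]
  convert! h (r • t) using 2
  · ext x
    rw [Finsupp.sum_smul_index (by simp)]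
    congr 1
    simp_rw [mul_assoc, ← Finsupp.mul_sum]
    push_cast; ring
  · rw [Finsupp.sum_smul_index (by simp)]
    simp_rw [mul_smul, ← Finsupp.smul_sum, norm_smul, mul_pow]
    push_cast
    congr 1
    rw [Real.coe_toNNReal _ (sq_nonneg _), ← Complex.ofReal_pow ‖r‖, Real.norm_eq_abs, sq_abs]
    push_cast
    ring

theorem memLp_finsuppSum (h : HasGaussianCov γ j) (t : ι →₀ ℝ) :
    MemLp (fun x => t.sum fun a s => s * x a) 2 γ := by
  have hm : Measurable fun x : ι → ℝ => t.sum fun a s => s * x a := by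
    unfold Finsupp.sum; fun_prop
  exact (memLp_id_gaussianReal 2).comp_measurePreserving ⟨hm, h.map_finsuppSum t⟩

theorem integral_finsuppSum (h : HasGaussianCov γ j) (t : ι →₀ ℝ) :
    ∫ x, (t.sum fun a s => s * x a) ∂γ = 0 := by
  have hm : Measurable fun x : ι → ℝ => t.sum fun a s => s * x a := by
    unfold Finsupp.sum; fun_prop
  have := integral_map (μ := γ) hm.aemeasurable (f := fun y : ℝ => y) (by fun_prop)
  rw [h.map_finsuppSum t, integral_id_gaussianReal] at this
  exact this.symm

theorem integral_finsuppSum_sq (h : HasGaussianCov γ j) (t : ι →₀ ℝ) :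
    ∫ x, (t.sum fun a s => s * x a) ^ 2 ∂γ = ‖t.sum fun a s => s • j a‖ ^ 2 := by
  have hm : Measurable fun x : ι → ℝ => t.sum fun a s => s * x a := by
    unfold Finsupp.sum; fun_prop
  have := integral_map (μ := γ) hm.aemeasurable (f := fun y : ℝ => y ^ 2) (by fun_prop)
  rw [h.map_finsuppSum t] at this
  rw [← this]
  have h2 := variance_eq_integral (μ := gaussianReal 0 (‖t.sum fun a s => s • j a‖ ^ 2).toNNReal)
    (X := fun x => x) (by fun_prop)
  rw [variance_fun_id_gaussianReal, integral_id_gaussianReal] at h2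
  simpa using h2.symm

theorem memLp (h : HasGaussianCov γ j) (a : ι) : MemLp (fun x => x a) 2 γ := by
  simpa using h.memLp_finsuppSum (Finsupp.single a 1)

theorem integral (h : HasGaussianCov γ j) (a : ι) : ∫ x, x a ∂γ = 0 := by
  simpa using h.integral_finsuppSum (Finsupp.single a 1)

theorem integral_sq (h : HasGaussianCov γ j) (a : ι) : ∫ x, x a ^ 2 ∂γ = ‖j a‖ ^ 2 := by
  simpa using h.integral_finsuppSum_sq (Finsupp.single a 1)

theorem integral_sub_sq (h : HasGaussianCov γ j) (a b : ι) :
    ∫ x, (x a - x b) ^ 2 ∂γ = ‖j a - j b‖ ^ 2 := by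
  classical
  have := h.integral_finsuppSum_sq (Finsupp.single a 1 - Finsupp.single b 1)
  have e1 (x : ι → ℝ) : (Finsupp.single a 1 - Finsupp.single b 1 : ι →₀ ℝ).sum
      (fun a s => s * x a) = x a - x b := by
    rw [Finsupp.sum_sub_index (by intros; ring)]; simp
  have e2 : (Finsupp.single a 1 - Finsupp.single b 1 : ι →₀ ℝ).sum
      (fun a s => s • j a) = j a - j b := by
    rw [Finsupp.sum_sub_index (by intros; rw [sub_smul])]; simp
  simpa [e1, e2] using this

/-- Polarization: second moments of differences are already known. -/
theorem integral_mul (h : HasGaussianCov γ j) (a b : ι) :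
    ∫ x, x a * x b ∂γ = inner ℝ (j a) (j b) := by
  have h1 : ∀ x : ι → ℝ, x a * x b = (x a ^ 2 + x b ^ 2 - (x a - x b) ^ 2) / 2 := by
    intro x; ring
  simp_rw [h1]
  rw [integral_div, integral_sub, integral_add, h.integral_sq, h.integral_sq, h.integral_sub_sq,
    norm_sub_sq_real]
  · ring
  · exact (h.memLp a).integrable_sq
  · exact (h.memLp b).integrable_sq
  · exact (h.memLp a).integrable_sq.add (h.memLp b).integrable_sq
  · exact ((h.memLp a).sub (h.memLp b)).integrable_sq

end HasGaussianCov

/-! ### Convergence in measure and asymptotic orthogonality -/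

/-- To check that `T a ⁻¹' s` tends to `s` in measure for all measurable `s`, it suffices to check
it on a generating family. -/
theorem tendsto_measure_symmDiff_preimage_of_le_generateFrom {Ω α : Type*} [mΩ : MeasurableSpace Ω]
    {μ : Measure Ω} [IsFiniteMeasure μ] {l : Filter α} {T : α → Ω → Ω}
    (hT : ∀ a, MeasurePreserving (T a) μ μ) {C : Set (Set Ω)}
    (hC : mΩ ≤ MeasurableSpace.generateFrom C) (hCm : ∀ s ∈ C, MeasurableSet s)
    (h : ∀ s ∈ C, Tendsto (fun a => μ ((T a ⁻¹' s) ∆ s)) l (𝓝 0)) {s : Set Ω}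
    (hs : MeasurableSet s) : Tendsto (fun a => μ ((T a ⁻¹' s) ∆ s)) l (𝓝 0) := by
  have key : MeasurableSet s ∧ Tendsto (fun a => μ ((T a ⁻¹' s) ∆ s)) l (𝓝 0) := by
    have hs' := hC s hs
    clear hs
    induction s, hs' using MeasurableSpace.generateFrom_induction with
    | hC t ht _ => exact ⟨hCm t ht, h t ht⟩
    | empty => simpa using tendsto_const_nhds
    | compl t ht ih =>
      refine ⟨ih.1.compl, ?_⟩
      simpa only [Set.preimage_compl, compl_symmDiff_compl] using ih.2
    | iUnion f hf ih =>
      have hUm : MeasurableSet (⋃ n, f n) := .iUnion fun n => (ih n).1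
      have hAm (n) : MeasurableSet (Set.accumulate f n) :=
        .biUnion (Set.to_countable _) fun n _ => (ih n).1
      have hA (n) : Tendsto (fun a => μ ((T a ⁻¹' Set.accumulate f n) ∆ Set.accumulate f n)) l
          (𝓝 0) := by
        induction n with
        | zero => simpa using (ih 0).2
        | succ n ihn =>
          refine tendsto_of_tendsto_of_tendsto_of_le_of_le tendsto_const_nhds
            (by simpa using ihn.add (ih (n + 1)).2) (fun _ => zero_le) fun a => ?_
          simp only [Set.accumulate_succ, Set.preimage_union]
          exact (measure_mono Set.union_symmDiff_union_subset).trans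
            (measure_union_le _ _)
      -- A countable union is approximated in measure by its finite partial unions, which satisfy
      -- the claim; since every `T a` preserves μ, the approximation error is the same after pulling
      -- back, whence ε / 3 three times.
      have hlim : Tendsto (fun n => μ ((Set.accumulate f n) ∆ ⋃ n, f n)) atTop (𝓝 0) := by
        have h1 : Tendsto (fun n => μ (⋃ n, f n) - μ (Set.accumulate f n)) atTop (𝓝 0) := by
          have := ENNReal.Tendsto.sub (tendsto_const_nhds (x := μ (⋃ n, f n)))
            (tendsto_measure_iUnion_accumulate (μ := μ) (f := f)) (.inl (measure_ne_top _ _))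
          simpa using this
        refine h1.congr fun n => ?_
        have hsub : Set.accumulate f n ⊆ ⋃ n, f n := Set.accumulate_subset_iUnion n
        rw [symmDiff_of_le hsub]
        exact (measure_sdiff hsub (hAm n).nullMeasurableSet (measure_ne_top _ _)).symm
      refine ⟨hUm, ENNReal.tendsto_nhds_zero.2 fun ε hε => ?_⟩
      have hε' : 0 < ε / 3 := ENNReal.div_pos hε.ne' (by simp)
      obtain ⟨n, hn⟩ := (ENNReal.tendsto_nhds_zero.1 hlim (ε / 3) hε').exists
      filter_upwards [ENNReal.tendsto_nhds_zero.1 (hA n) (ε / 3) hε'] with a ha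
      calc _ ≤ μ ((T a ⁻¹' ⋃ n, f n) ∆ (T a ⁻¹' Set.accumulate f n))
            + μ ((T a ⁻¹' Set.accumulate f n) ∆ Set.accumulate f n)
            + μ ((Set.accumulate f n) ∆ ⋃ n, f n) :=
          (measure_symmDiff_le _ (Set.accumulate f n) _).trans
            (add_le_add_left (measure_symmDiff_le _ _ _) _)
        _ ≤ ε / 3 + ε / 3 + ε / 3 := by
          refine add_le_add (add_le_add ?_ ha) hn
          rw [← Set.preimage_symmDiff, (hT a).measure_preimage (hUm.symmDiff (hAm n)).nullMeasurableSet,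
            symmDiff_comm]
          exact hn
        _ = ε := ENNReal.add_thirds ε
  exact key.2

/-- The two sets have equal measure, so the two halves of the symmetric difference do too and only
{Y < r} \ {Z < r} needs a bound. On it, either Y lies in [r - δ, r), which has small measure for
small δ, or Z - Y ≥ δ, which Chebyshev's inequality controls. -/
theorem tendsto_measure_symmDiff_lt_of_tendsto_integral_sq {Ω α : Type*} [MeasurableSpace Ω]
    {μ : Measure Ω} [IsFiniteMeasure μ] {l : Filter α} {Y : Ω → ℝ} {Z : α → Ω → ℝ}
    (hY : Measurable Y) (hZ : ∀ a, Measurable (Z a)) (r : ℝ)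
    (heq : ∀ a, μ {x | Z a x < r} = μ {x | Y x < r})
    (hi : ∀ a, Integrable (fun x => (Z a x - Y x) ^ 2) μ)
    (h : Tendsto (fun a => ∫ x, (Z a x - Y x) ^ 2 ∂μ) l (𝓝 0)) :
    Tendsto (fun a => μ ({x | Z a x < r} ∆ {x | Y x < r})) l (𝓝 0) := by
  have hYm : MeasurableSet {x | Y x < r} := measurableSet_lt hY measurable_const
  have hZm (a) : MeasurableSet {x | Z a x < r} := measurableSet_lt (hZ a) measurable_const
  have h2 (a) : μ ({x | Z a x < r} ∆ {x | Y x < r})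
      = 2 * μ ({x | Y x < r} \ {x | Z a x < r}) := by
    rw [measure_symmDiff_eq (hZm a).nullMeasurableSet hYm.nullMeasurableSet, two_mul]
    congr 1
    have e1 := measure_inter_add_sdiff {x | Z a x < r} hYm (μ := μ)
    have e2 := measure_inter_add_sdiff {x | Y x < r} (hZm a) (μ := μ)
    rw [heq a, ← e2, Set.inter_comm] at e1
    exact (ENNReal.add_right_inj (measure_ne_top _ _)).1 e1
  simp_rw [h2]
  rw [show (0 : ENNReal) = 2 * 0 by simp]
  refine ENNReal.Tendsto.const_mul ?_ (by simp)
  have hδ : Tendsto (fun n : ℕ => μ {x | r - 1 / (n + 1 : ℝ) ≤ Y x ∧ Y x < r}) atTop (𝓝 0) := by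
    have hempty : ⋂ n : ℕ, {x | r - 1 / (n + 1 : ℝ) ≤ Y x ∧ Y x < r} = ∅ := by
      ext x
      simp only [Set.mem_iInter, Set.mem_ofPred_eq, Set.mem_empty_iff_false, iff_false, not_forall]
      by_cases hx : Y x < r
      · obtain ⟨n, hn⟩ := exists_nat_one_div_lt (sub_pos.2 hx)
        exact ⟨n, fun h => by linarith [h.1]⟩
      · exact ⟨0, fun h => hx h.2⟩
    have := tendsto_measure_iInter_atTop (μ := μ)
      (s := fun n : ℕ => {x | r - 1 / (n + 1 : ℝ) ≤ Y x ∧ Y x < r})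
      (fun n => ((measurableSet_le measurable_const hY).inter hYm).nullMeasurableSet)
      (fun a b hab x hx => ⟨by
        have := one_div_le_one_div_of_le (by positivity : (0 : ℝ) < a + 1)
          (by exact_mod_cast Nat.succ_le_succ hab : (a + 1 : ℝ) ≤ b + 1)
        linarith [hx.1], hx.2⟩) ⟨0, measure_ne_top _ _⟩
    rwa [hempty, measure_empty] at this
  rw [ENNReal.tendsto_nhds_zero]
  intro ε hε
  obtain ⟨n, hn⟩ := ((ENNReal.tendsto_nhds_zero.1 hδ) (ε / 2) (ENNReal.half_pos hε.ne')).exists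
  set δ : ℝ := 1 / (n + 1 : ℝ) with hδdef
  have hδ0 : 0 < δ := by positivity
  have hcheb (a) : μ {x | δ ^ 2 ≤ (Z a x - Y x) ^ 2}
      ≤ ENNReal.ofReal ((∫ x, (Z a x - Y x) ^ 2 ∂μ) / δ ^ 2) := by
    have := mul_meas_ge_le_integral_of_nonneg (ae_of_all _ fun x => sq_nonneg (Z a x - Y x))
      (hi a) (δ ^ 2)
    rw [← ENNReal.ofReal_toReal (measure_ne_top μ {x | δ ^ 2 ≤ (Z a x - Y x) ^ 2})]
    refine ENNReal.ofReal_le_ofReal ?_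
    rw [le_div_iff₀ (by positivity), mul_comm]
    exact this
  have hlim : Tendsto (fun a => ENNReal.ofReal ((∫ x, (Z a x - Y x) ^ 2 ∂μ) / δ ^ 2)) l (𝓝 0) := by
    have := ENNReal.tendsto_ofReal (h.div_const (δ ^ 2))
    simpa using this
  filter_upwards [(ENNReal.tendsto_nhds_zero.1 hlim) (ε / 2) (ENNReal.half_pos hε.ne')] with a ha
  calc _ ≤ μ ({x | r - δ ≤ Y x ∧ Y x < r} ∪ {x | δ ^ 2 ≤ (Z a x - Y x) ^ 2}) := by
        refine measure_mono fun x hx => ?_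
        obtain ⟨h1, h2⟩ := hx
        simp only [Set.mem_ofPred_eq, not_lt] at h1 h2
        by_cases h3 : r - δ ≤ Y x
        · exact Or.inl ⟨h3, h1⟩
        · refine Or.inr ?_
          simp only [Set.mem_ofPred_eq]
          have : δ ≤ Z a x - Y x := by linarith
          gcongr
    _ ≤ _ := measure_union_le _ _
    _ ≤ ε / 2 + ε / 2 := add_le_add hn ((hcheb a).trans ha)
    _ = ε := ENNReal.add_halves ε

/-- A vector having a constant inner product with a bounded family of asymptotically orthogonal
vectors is orthogonal to it. -/
theorem eq_zero_of_inner_eq_of_tendsto_inner {H α : Type*} [NormedAddCommGroup H]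
    [InnerProductSpace ℂ H] [CompleteSpace H] {l : Filter α} [l.NeBot] {f : α → H} {C : ℝ}
    (hC : ∀ a, ‖f a‖ ≤ C) (hf : ∀ b, Tendsto (fun a => inner ℂ (f b) (f a)) l (𝓝 0))
    {y : H} {c : ℂ} (hy : ∀ a, inner ℂ y (f a) = c) : c = 0 := by
  -- By boundedness, f tends weakly to 0 against every vector of its closed span W. Projecting y to
  -- W does not change its inner products with f, so c is also the limit 0.
  let W : Submodule ℂ H := (Submodule.span ℂ (Set.range f)).topologicalClosure
  have : CompleteSpace W := (Submodule.isClosed_topologicalClosure _).completeSpace_coe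
  have hW : ∀ z ∈ W, Tendsto (fun a => inner ℂ z (f a)) l (𝓝 0) := by
    have hspan : ∀ z ∈ Submodule.span ℂ (Set.range f),
        Tendsto (fun a => inner ℂ z (f a)) l (𝓝 0) := by
      intro z hz
      induction hz using Submodule.span_induction with
      | mem z hz => obtain ⟨b, rfl⟩ := hz; exact hf b
      | zero => simp
      | add z w _ _ h1 h2 => simpa [inner_add_left] using h1.add h2
      | smul r z _ h => simpa [inner_smul_left, mul_comm] using h.const_mul (conj r)
    intro z hz
    rw [Metric.tendsto_nhds]
    intro ε hε
    have hC' : 0 < |C| + 1 := by positivity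
    obtain ⟨w, hw, hzw⟩ := Metric.mem_closure_iff.1 hz (ε / 2 / (|C| + 1)) (by positivity)
    filter_upwards [Metric.tendsto_nhds.1 (hspan w hw) (ε / 2) (half_pos hε)] with a ha
    rw [dist_zero_right] at ha ⊢
    have : inner ℂ z (f a) = inner ℂ (z - w) (f a) + inner ℂ w (f a) := by
      rw [← inner_add_left, sub_add_cancel]
    rw [this]
    refine (norm_add_le _ _).trans_lt ?_
    have h1 : ‖inner ℂ (z - w) (f a)‖ ≤ ε / 2 := by
      refine (norm_inner_le_norm _ _).trans ?_
      rw [dist_eq_norm] at hzw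
      calc _ ≤ ε / 2 / (|C| + 1) * (|C| + 1) := by
            gcongr
            exact (hC a).trans ((le_abs_self C).trans (by linarith))
        _ = ε / 2 := div_mul_cancel₀ _ hC'.ne'
    linarith
  have h1 (a) : inner ℂ (W.starProjection y) (f a) = c := by
    have hfa : f a ∈ W := Submodule.le_topologicalClosure _ (Submodule.subset_span ⟨a, rfl⟩)
    rw [← hy a, Submodule.inner_starProjection_left_eq_right,
      Submodule.starProjection_eq_self_iff.2 hfa]
  have h2 := hW (W.starProjection y) (W.starProjection_apply_mem y)
  simp_rw [h1] at h2
  exact tendsto_nhds_unique tendsto_const_nhds h2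

/-! ### The product of a Gaussian shift with a compact translation -/

namespace HasGaussianCov

variable {ι E : Type*} [NormedAddCommGroup E] [InnerProductSpace ℝ E]
  {γ : Measure (ι → ℝ)} [IsProbabilityMeasure γ] {j : ι → E}

theorem inner_finsuppSum (s t : ι →₀ ℝ) (j₁ j₂ : ι → E) :
    inner ℝ (s.sum fun a r => r • j₁ a) (t.sum fun a r => r • j₂ a)
      = s.sum fun a r => t.sum fun b r' => r * (r' * inner ℝ (j₁ a) (j₂ b)) := by
  simp only [Finsupp.sum, sum_inner, inner_sum, real_inner_smul_left, real_inner_smul_right]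
  rw [Finset.sum_comm]
  simp only [mul_left_comm]

theorem norm_finsuppSum_eq (t : ι →₀ ℝ) {j₁ j₂ : ι → E}
    (h : ∀ a b, inner ℝ (j₁ a) (j₁ b) = inner ℝ (j₂ a) (j₂ b)) :
    ‖t.sum fun a r => r • j₁ a‖ = ‖t.sum fun a r => r • j₂ a‖ := by
  rw [norm_eq_sqrt_real_inner, norm_eq_sqrt_real_inner, inner_finsuppSum, inner_finsuppSum]
  simp_rw [h]

/-- The law is determined by the Gram matrix of j, which σ does not change. -/
theorem measurePreserving_comp (h : HasGaussianCov γ j) (σ : ι → ι)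
    (hσ : ∀ a b, inner ℝ (j (σ a)) (j (σ b)) = inner ℝ (j a) (j b)) :
    MeasurePreserving (fun (x : ι → ℝ) a => x (σ a)) γ γ := by
  have hm : Measurable fun (x : ι → ℝ) a => x (σ a) := by fun_prop
  refine ⟨hm, ?_⟩
  have := Measure.isProbabilityMeasure_map hm.aemeasurable (μ := γ)
  refine ext_of_integral_exp_finsuppSum fun t => ?_
  rw [integral_map hm.aemeasurable (Measurable.aestronglyMeasurable (by
    unfold Finsupp.sum; fun_prop)), h t]
  convert h (t.mapDomain σ) using 4
  · rw [Finsupp.sum_mapDomain_index (by simp) (by intros; ring)]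
  · rw [Finsupp.sum_mapDomain_index (by simp) (by intros; rw [add_smul]),
      norm_finsuppSum_eq t hσ]

end HasGaussianCov

section System

variable {G : Type*} [Group G] {ι K : Type*} [MulAction G ι]
  [Group K] [TopologicalSpace K] [IsTopologicalGroup K]
  [MeasurableSpace K] [BorelSpace K]
  {E : Type*} [NormedAddCommGroup E] [InnerProductSpace ℝ E]
  {γ : Measure (ι → ℝ)} [IsProbabilityMeasure γ] {j : ι → E}
  {m : Measure K} [IsProbabilityMeasure m] [m.IsMulLeftInvariant]

/-- The product of the shift on `ι → ℝ` with the translation of `K` by a homomorphism `κ`. -/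
def shiftTranslate (κ : G →* K) (g : G) (p : (ι → ℝ) × K) : (ι → ℝ) × K :=
  (fun a => p.1 (g⁻¹ • a), κ g * p.2)

theorem measurePreserving_shiftTranslate (h : HasGaussianCov γ j)
    (hj : ∀ (g : G) a b, inner ℝ (j (g • a)) (j (g • b)) = inner ℝ (j a) (j b))
    (κ : G →* K) (g : G) :
    MeasurePreserving (shiftTranslate κ g) (γ.prod m) (γ.prod m) :=
  (h.measurePreserving_comp (fun a => g⁻¹ • a) (hj g⁻¹)).prod (measurePreserving_mul_left m (κ g))

/-- It suffices to treat generating sets. For half-spaces {x_a < r}, the coordinates move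
continuously in L² because the orbits of j are continuous. For sets depending on K only, it is the
continuity of translation in measure. -/
theorem tendsto_measure_symmDiff_shiftTranslate [TopologicalSpace G] [CompactSpace K] (h : HasGaussianCov γ j)
    (hj : ∀ (g : G) a b, inner ℝ (j (g • a)) (j (g • b)) = inner ℝ (j a) (j b))
    [ContinuousInv G]
    (hjc : ∀ a, Continuous fun g : G => j (g • a)) [m.Regular] {κ : G →* K} (hκ : Continuous κ)
    {s : Set ((ι → ℝ) × K)} (hs : MeasurableSet s) :
    Tendsto (fun g => (γ.prod m) ((shiftTranslate κ g ⁻¹' s) ∆ s)) (𝓝 1) (𝓝 0) := by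
  have hT (g : G) := measurePreserving_shiftTranslate (m := m) h hj κ g
  refine tendsto_measure_symmDiff_preimage_of_le_generateFrom (C :=
    {s | ∃ a r, s = {p : (ι → ℝ) × K | p.1 a < r}} ∪ {s | ∃ B, MeasurableSet B ∧ s = Prod.snd ⁻¹' B})
    hT ?_ ?_ ?_ hs
  · refine sup_le ?_ ?_
    · rw [MeasurableSpace.pi, MeasurableSpace.comap_iSup]
      refine iSup_le fun a => ?_
      rw [MeasurableSpace.comap_comp, BorelSpace.measurable_eq (α := ℝ), borel_eq_generateFrom_Iio,
        MeasurableSpace.comap_generateFrom]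
      refine MeasurableSpace.generateFrom_mono ?_
      rintro _ ⟨_, ⟨r, rfl⟩, rfl⟩
      exact Or.inl ⟨a, r, rfl⟩
    · rintro _ ⟨B, hB, rfl⟩
      exact MeasurableSpace.measurableSet_generateFrom (Or.inr ⟨B, hB, rfl⟩)
  · rintro _ (⟨a, r, rfl⟩ | ⟨B, hB, rfl⟩)
    · exact measurableSet_lt (by fun_prop) measurable_const
    · exact measurable_snd hB
  · have hfst : MeasurePreserving Prod.fst (γ.prod m) γ := measurePreserving_fst
    have hsnd : MeasurePreserving Prod.snd (γ.prod m) m := measurePreserving_snd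
    rintro _ (⟨a, r, rfl⟩ | ⟨B, hB, rfl⟩)
    · have hlt (b : ι) : MeasurableSet {p : (ι → ℝ) × K | p.1 b < r} :=
        measurableSet_lt (by fun_prop) measurable_const
      have hint (b c : ι) : ∫ p, (p.1 b - p.1 c) ^ 2 ∂(γ.prod m) = ‖j b - j c‖ ^ 2 := by
        have := integral_map (μ := γ.prod m) (φ := Prod.fst) (by fun_prop)
          (f := fun x : ι → ℝ => (x b - x c) ^ 2) (Measurable.aestronglyMeasurable (by fun_prop))
        rw [← this, hfst.map_eq, h.integral_sub_sq]
      refine tendsto_measure_symmDiff_lt_of_tendsto_integral_sq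
        (Y := fun p : (ι → ℝ) × K => p.1 a) (Z := fun (g : G) p => p.1 (g⁻¹ • a))
        (by fun_prop) (by fun_prop) r (fun g => (hT g).measure_preimage (hlt a).nullMeasurableSet)
        (fun g => ?_) ?_
      · exact (((h.memLp (g⁻¹ • a)).sub (h.memLp a)).integrable_sq).comp_fst m
      · simp_rw [hint]
        have : Continuous fun g : G => ‖j (g⁻¹ • a) - j a‖ ^ 2 :=
          ((((hjc a).comp continuous_inv).sub continuous_const).norm.pow 2)
        simpa using this.tendsto 1
    · let f : C(G × K, K) := ⟨fun p => κ p.1 * p.2, by fun_prop⟩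
      have hmp (k : K) : MeasurePreserving (fun x => k * x) m m := measurePreserving_mul_left m k
      have hlim := tendsto_measure_symmDiff_preimage_nhds_zero (μ := m) (ν := m) (s := B)
        (f.curry.continuous.tendsto 1) (Eventually.of_forall fun g => hmp (κ g))
        (by have := hmp (κ 1); exact this) hB.nullMeasurableSet (measure_ne_top _ _)
      refine hlim.congr fun g => ?_
      have h1 : (⇑(f.curry 1) ⁻¹' B) = B := by ext; simp [f]
      have h2 : (⇑(f.curry g) ⁻¹' B) = (fun x => κ g * x) ⁻¹' B := rfl
      rw [h1, h2, ← hsnd.measure_preimage ((((hmp (κ g)).measurable hB).symmDiff hB).nullMeasurableSet)]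
      rfl

end System

/-! ### Ergodicity of the product -/

section Ergodic

variable {G : Type*} [Group G] {ι K : Type*} [MulAction G ι]
  [Group K] [TopologicalSpace K] [IsTopologicalGroup K]
  [MeasurableSpace K] [BorelSpace K]
  {E : Type*} [NormedAddCommGroup E] [InnerProductSpace ℝ E]
  {γ : Measure (ι → ℝ)} {j : ι → E}
  {m : Measure K} [IsProbabilityMeasure m] [m.IsMulLeftInvariant]

/-- The character `x ↦ exp (i ∑ t_a x_a)` of `ι → ℝ`. -/
noncomputable def piChar (t : ι →₀ ℝ) (x : ι → ℝ) : ℂ :=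
  Complex.exp (Complex.I * (t.sum fun a s => s * x a : ℝ))

@[fun_prop]
theorem measurable_piChar (t : ι →₀ ℝ) : Measurable (piChar t) := by
  unfold piChar Finsupp.sum; fun_prop

theorem norm_piChar (t : ι →₀ ℝ) (x : ι → ℝ) : ‖piChar t x‖ = 1 := by
  rw [piChar, mul_comm, Complex.norm_exp_ofReal_mul_I]

theorem piChar_sub (s t : ι →₀ ℝ) (x : ι → ℝ) :
    piChar (s - t) x = conj (piChar t x) * piChar s x := by
  classical
  simp only [piChar, ← Complex.exp_conj, map_mul, Complex.conj_I, Complex.conj_ofReal]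
  rw [← Complex.exp_add, Finsupp.sum_sub_index (by intros; ring)]
  congr 1
  push_cast; ring

theorem piChar_comp (t : ι →₀ ℝ) (σ : ι → ι) (x : ι → ℝ) :
    piChar t (fun a => x (σ a)) = piChar (t.mapDomain σ) x := by
  rw [piChar, piChar, Finsupp.sum_mapDomain_index (by simp) (by intros; ring)]

theorem HasGaussianCov.integral_piChar (h : HasGaussianCov γ j) (t : ι →₀ ℝ) :
    ∫ x, piChar t x ∂γ = Real.exp (-‖t.sum fun a s => s • j a‖ ^ 2 / 2) := h t

variable [IsProbabilityMeasure γ]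

theorem integrable_piChar (t : ι →₀ ℝ) : Integrable (piChar t) γ :=
  Integrable.of_bound (C := 1) (by fun_prop) (ae_of_all _ fun x => (norm_piChar t x).le)

/-- This formula turns asymptotic orthogonality in E into mixing: the covariance of two centered
characters vanishes as the inner product of their vectors tends to 0. -/
theorem HasGaussianCov.integral_centered_mul (h : HasGaussianCov γ j) (s t : ι →₀ ℝ) (c : ℝ)
    (hs : Real.exp (-‖s.sum fun a s => s • j a‖ ^ 2 / 2) = c)
    (ht : Real.exp (-‖t.sum fun a s => s • j a‖ ^ 2 / 2) = c) :
    ∫ x, conj (piChar t x - c) * (piChar s x - c) ∂γ =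
      (c ^ 2 * (Real.exp (inner ℝ (s.sum fun a r => r • j a) (t.sum fun a r => r • j a)) - 1) : ℝ) := by
  classical
  have hconj : ∫ x, conj (piChar t x) ∂γ = c := by
    rw [integral_conj, h.integral_piChar, ht, Complex.conj_ofReal]
  have h1 (x : ι → ℝ) : conj (piChar t x - c) * (piChar s x - c) =
      piChar (s - t) x - c * conj (piChar t x) - c * piChar s x + (c : ℂ) ^ 2 := by
    rw [piChar_sub, map_sub, Complex.conj_ofReal]; ring
  have hci : Integrable (fun x => conj (piChar t x)) γ :=
    Integrable.of_bound (C := 1) (Measurable.aestronglyMeasurable (by fun_prop))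
      (ae_of_all _ fun x => by rw [RCLike.norm_conj, norm_piChar])
  simp_rw [h1]
  rw [integral_add, integral_sub, integral_sub, integral_const_mul, integral_const_mul, hconj,
    h.integral_piChar, h.integral_piChar, hs, Finsupp.sum_sub_index (by intros; rw [sub_smul]),
    norm_sub_sq_real]
  · have : Real.exp (-(‖s.sum fun a s => s • j a‖ ^ 2 - 2 * inner ℝ (s.sum fun a r => r • j a)
        (t.sum fun a r => r • j a) + ‖t.sum fun a s => s • j a‖ ^ 2) / 2)
        = c * c * Real.exp (inner ℝ (s.sum fun a r => r • j a) (t.sum fun a r => r • j a)) := by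
      nth_rw 1 [← hs]
      rw [← ht, ← Real.exp_add, ← Real.exp_add]
      congr 1; ring
    rw [this]
    simp
    ring
  · exact integrable_piChar _
  · exact hci.const_mul _
  · exact (integrable_piChar _).sub (hci.const_mul _)
  · exact (integrable_piChar _).const_mul _
  · exact ((integrable_piChar _).sub (hci.const_mul _)).sub ((integrable_piChar _).const_mul _)
  · exact integrable_const _

/-- Let F be the centered character times the indicator of B. The translates of F are asymptotically
orthogonal along l, while invariance of A makes their inner product with the indicator of A
constant. That constant is therefore 0, which is the stated identity. -/
theorem setIntegral_piChar_of_invariant (h : HasGaussianCov γ j)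
    (hj : ∀ (g : G) a b, inner ℝ (j (g • a)) (j (g • b)) = inner ℝ (j a) (j b))
    {l : Filter G} [l.NeBot] (hl : ∀ a b, Tendsto (fun g => inner ℝ (j (g • a)) (j b)) l (𝓝 0))
    (κ : G →* K) {A : Set ((ι → ℝ) × K)} (hA : MeasurableSet A)
    (hAinv : ∀ g, shiftTranslate κ g ⁻¹' A =ᵐ[γ.prod m] A) (t : ι →₀ ℝ) {B : Set K}
    (hB : MeasurableSet B) :
    ∫ p in A ∩ Prod.snd ⁻¹' B, piChar t p.1 ∂(γ.prod m)
      = Real.exp (-‖t.sum fun a s => s • j a‖ ^ 2 / 2) *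
        (γ.prod m).real (A ∩ Prod.snd ⁻¹' B) := by
  set c : ℝ := Real.exp (-‖t.sum fun a s => s • j a‖ ^ 2 / 2) with hc
  have hT (g : G) := measurePreserving_shiftTranslate (m := m) h hj κ g
  let F : (ι → ℝ) × K → ℂ := fun p => (piChar t p.1 - c) * B.indicator 1 p.2
  have hFm : Measurable F :=
    (((measurable_piChar t).comp measurable_fst).sub_const _).mul
      ((measurable_one.indicator hB).comp measurable_snd)
  have hFb (p) : ‖F p‖ ≤ 1 + |c| := by
    simp only [F, norm_mul]
    have h1 : ‖(B.indicator 1 p.2 : ℂ)‖ ≤ 1 := by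
      by_cases hp : p.2 ∈ B <;> simp [hp]
    have h2 : ‖piChar t p.1 - c‖ ≤ 1 + |c| :=
      (norm_sub_le _ _).trans (by rw [norm_piChar, Complex.norm_real, Real.norm_eq_abs])
    calc _ ≤ (1 + |c|) * 1 := by gcongr
      _ = _ := mul_one _
  have hF : MemLp F 2 (γ.prod m) := MemLp.of_bound hFm.aestronglyMeasurable _ (ae_of_all _ hFb)
  have hFg (g : G) : MemLp (fun p => F (shiftTranslate κ g p)) 2 (γ.prod m) :=
    hF.comp_measurePreserving (hT g)
  have hinner (f₁ f₂ : (ι → ℝ) × K → ℂ) (h₁ : MemLp f₁ 2 (γ.prod m)) (h₂ : MemLp f₂ 2 (γ.prod m)) :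
      inner ℂ (h₁.toLp f₁) (h₂.toLp f₂) = ∫ p, conj (f₁ p) * f₂ p ∂(γ.prod m) := by
    rw [L2.inner_def]
    refine integral_congr_ae ?_
    filter_upwards [h₁.coeFn_toLp, h₂.coeFn_toLp] with p e1 e2
    rw [e1, e2, RCLike.inner_apply, mul_comm]
  have hy : MemLp (A.indicator (1 : (ι → ℝ) × K → ℂ)) 2 (γ.prod m) :=
    (memLp_const (1 : ℂ)).indicator hA
  have hyF : inner ℂ (hy.toLp _) (hF.toLp F) = 0 := by
    refine eq_zero_of_inner_eq_of_tendsto_inner (l := l) (f := fun g => (hFg g).toLp _)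
      (y := hy.toLp _) (C := ‖hF.toLp F‖) (fun g => ?_) (fun g' => ?_) (fun g => ?_)
    · rw [Lp.norm_toLp, Lp.norm_toLp]
      exact (congrArg ENNReal.toReal
        (eLpNorm_comp_measurePreserving hFm.aestronglyMeasurable (hT g))).le
    · have hnorm (g : G) : Real.exp (-‖(t.mapDomain fun a => g⁻¹ • a).sum fun a s => s • j a‖ ^ 2 / 2)
          = c := by
        rw [Finsupp.sum_mapDomain_index (by simp) (by intros; rw [add_smul]),
          HasGaussianCov.norm_finsuppSum_eq t (hj g⁻¹)]
      let D : G → ℝ := fun g => inner ℝ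
        ((t.mapDomain fun a => g⁻¹ • a).sum fun a r => r • j a)
        ((t.mapDomain fun a => g'⁻¹ • a).sum fun a r => r • j a)
      have hD : Tendsto D l (𝓝 0) := by
        have hDe (g : G) : D g = ∑ a ∈ t.support, ∑ b ∈ t.support,
            t a * (t b * inner ℝ (j (g • g'⁻¹ • b)) (j a)) := by
          simp only [D]
          rw [Finsupp.sum_mapDomain_index (by simp) (by intros; rw [add_smul]),
            Finsupp.sum_mapDomain_index (by simp) (by intros; rw [add_smul]),
            HasGaussianCov.inner_finsuppSum]
          refine Finset.sum_congr rfl fun a _ => Finset.sum_congr rfl fun b _ => ?_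
          simp only
          rw [← hj g (g⁻¹ • a), smul_inv_smul, real_inner_comm]
        rw [funext hDe]
        rw [← Finset.sum_const_zero (s := t.support)]
        refine tendsto_finsetSum _ fun a _ => ?_
        rw [← Finset.sum_const_zero (s := t.support)]
        refine tendsto_finsetSum _ fun b _ => ?_
        simpa using ((hl (g'⁻¹ • b) a).const_mul (t b)).const_mul (t a)
      have hlim : Tendsto (fun g => c ^ 2 * (Real.exp (D g) - 1)) l (𝓝 0) := by
        have := (((Real.continuous_exp.tendsto 0).comp hD).sub_const 1).const_mul (c ^ 2)
        simpa using this
      refine squeeze_zero_norm (fun g => ?_) (by simpa only [norm_zero] using hlim.norm)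
      rw [hinner]
      have hprod (p : (ι → ℝ) × K) :
          conj (F (shiftTranslate κ g' p)) * F (shiftTranslate κ g p) =
          (conj (piChar (t.mapDomain fun a => g'⁻¹ • a) p.1 - c) *
            (piChar (t.mapDomain fun a => g⁻¹ • a) p.1 - c)) *
          (B.indicator 1 (κ g' * p.2) * B.indicator 1 (κ g * p.2)) := by
        have hb : conj (B.indicator (1 : K → ℂ) (κ g' * p.2)) = B.indicator 1 (κ g' * p.2) := by
          by_cases hp : κ g' * p.2 ∈ B <;> simp [hp]
        have hF' (g : G) : F (shiftTranslate κ g p) =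
            (piChar (t.mapDomain fun a => g⁻¹ • a) p.1 - c) * B.indicator 1 (κ g * p.2) := by
          simp only [F, shiftTranslate]
          rw [piChar_comp t (fun a => g⁻¹ • a)]
        rw [hF', hF', map_mul, hb]
        ring
      simp_rw [hprod]
      rw [integral_prod_mul (μ := γ) (ν := m)
        (fun x => conj (piChar (t.mapDomain fun a => g'⁻¹ • a) x - c) *
            (piChar (t.mapDomain fun a => g⁻¹ • a) x - c))
        (fun k => B.indicator 1 (κ g' * k) * B.indicator 1 (κ g * k)),
        h.integral_centered_mul _ _ c (hnorm g) (hnorm g'), norm_mul, Complex.norm_real]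
      -- The factor from K need not decay; it is at most 1, and the Gaussian factor supplies the
      -- decay.
      refine mul_le_of_le_one_right (norm_nonneg _) ?_
      refine (norm_integral_le_of_norm_le_const (C := 1) (ae_of_all _ fun k => ?_)).trans (by simp)
      by_cases h1 : κ g' * k ∈ B <;> by_cases h2 : κ g * k ∈ B <;> simp [h1, h2]
    · rw [hinner, hinner]
      have hm : Measurable fun p => conj (A.indicator (1 : (ι → ℝ) × K → ℂ) p) * F p :=
        (Complex.continuous_conj.measurable.comp (measurable_one.indicator hA)).mul hFm
      have h1 := integral_map (μ := γ.prod m) (hT g).measurable.aemeasurable hm.aestronglyMeasurable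
      rw [(hT g).map_eq] at h1
      rw [h1]
      refine integral_congr_ae ?_
      filter_upwards [hAinv g] with p hp
      have hp' : shiftTranslate κ g p ∈ A ↔ p ∈ A := iff_of_eq hp
      by_cases hpA : p ∈ A <;> simp [hpA, hp']
  rw [hinner] at hyF
  have hi : IntegrableOn (fun p : (ι → ℝ) × K => piChar t p.1) (A ∩ Prod.snd ⁻¹' B) (γ.prod m) :=
    ((integrable_piChar t).comp_fst m).integrableOn
  have h1 : ∫ p, conj (A.indicator (1 : (ι → ℝ) × K → ℂ) p) * F p ∂(γ.prod m)
      = ∫ p in A ∩ Prod.snd ⁻¹' B, (piChar t p.1 - c) ∂(γ.prod m) := by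
    rw [← integral_indicator (hA.inter (measurable_snd hB))]
    congr 1
    ext p
    by_cases hpA : p ∈ A <;> by_cases hpB : p.2 ∈ B <;> simp [F, hpA, hpB]
  rw [h1, integral_sub hi (integrable_const _), sub_eq_zero, setIntegral_const] at hyF
  rw [hyF, Complex.real_smul, mul_comm]

end Ergodic

section Ergodic

/-- A compact group acts ergodically on itself by translations. -/
theorem ergodicSMul_self_of_compactSpace {K : Type*} [Group K] [TopologicalSpace K]
    [IsTopologicalGroup K] [CompactSpace K] [MeasurableSpace K] [BorelSpace K]
    (m : Measure K) [m.IsHaarMeasure] [m.Regular] : ErgodicSMul K K m where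
  measure_preimage_smul c s hs := (measurePreserving_mul_left m c).measure_preimage hs.nullMeasurableSet
  aeconst_of_forall_preimage_smul_ae_eq {s} hs hinv := by
    -- The restriction of m to an invariant set is again left invariant, hence a multiple of m by
    -- uniqueness of Haar measure; it vanishes on the complement of s, so either the multiple or
    -- that complement is null.
    have hreg : (m.restrict s).Regular := Measure.Regular.restrict_of_measure_ne_top (measure_ne_top m s)
    have hleft : (m.restrict s).IsMulLeftInvariant := by
      refine ⟨fun k => Measure.ext fun B hB => ?_⟩
      have hm : Measurable fun x => k * x := measurable_const_mul k
      rw [Measure.map_apply hm hB, Measure.restrict_apply (hm hB), Measure.restrict_apply hB,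
        ← (measurePreserving_mul_left m k).measure_preimage (hB.inter hs).nullMeasurableSet,
        Set.preimage_inter]
      exact measure_congr ((EventuallyEq.refl _ _).inter (hinv k).symm)
    have heq := Measure.isMulLeftInvariant_eq_smul_of_regular (m.restrict s) m
    have h1 : (m.restrict s) sᶜ = 0 := by rw [Measure.restrict_apply hs.compl]; simp
    rw [eventuallyConst_set']
    rw [heq, Measure.smul_apply, smul_eq_zero] at h1
    rcases h1 with h1 | h1
    · left
      rw [ae_eq_empty, ← Measure.restrict_apply_univ, heq, h1, zero_smul]
      rfl
    · right
      rwa [ae_eq_univ]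

variable {G : Type*} [Group G] {ι K : Type*} [MulAction G ι]
  [Group K] [TopologicalSpace K] [IsTopologicalGroup K] [CompactSpace K]
  [MeasurableSpace K] [BorelSpace K]
  {E : Type*} [NormedAddCommGroup E] [InnerProductSpace ℝ E]
  {γ : Measure (ι → ℝ)} [IsProbabilityMeasure γ] {j : ι → E}
  {m : Measure K} [IsProbabilityMeasure m] [m.IsHaarMeasure] [m.Regular]

/-- By `setIntegral_piChar_of_invariant` the measure restricted to A is γ × ν, with ν its marginal
on K. The support of the density of ν is invariant under the dense image of κ, so it is null or
conull. If null, ν = 0 and A is null. If conull, the product measure is absolutely continuous with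
respect to γ × ν, which does not charge the complement of A. -/
theorem ergodic_shiftTranslate (h : HasGaussianCov γ j)
    (hj : ∀ (g : G) a b, inner ℝ (j (g • a)) (j (g • b)) = inner ℝ (j a) (j b))
    {l : Filter G} [l.NeBot] (hl : ∀ a b, Tendsto (fun g => inner ℝ (j (g • a)) (j b)) l (𝓝 0))
    {κ : G →* K} (hκ : DenseRange κ) {A : Set ((ι → ℝ) × K)} (hA : MeasurableSet A)
    (hAinv : ∀ g, shiftTranslate κ g ⁻¹' A =ᵐ[γ.prod m] A) :
    EventuallyConst A (ae (γ.prod m)) := by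
  have hT (g : G) := measurePreserving_shiftTranslate (m := m) h hj κ g
  let ν : Measure K := ((γ.prod m).restrict A).snd
  have hνapp (B : Set K) (hB : MeasurableSet B) : ν B = (γ.prod m) (Prod.snd ⁻¹' B ∩ A) := by
    rw [Measure.snd_apply hB, Measure.restrict_apply (measurable_snd hB)]
  have heq : (γ.prod m).restrict A = γ.prod ν := by
    refine ext_of_setIntegral_exp_finsuppSum fun t B hB => ?_
    have h1 := setIntegral_piChar_of_invariant h hj hl κ hA hAinv t hB
    rw [Measure.restrict_restrict (measurable_snd hB), Set.inter_comm]
    refine h1.trans ?_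
    have h2 : (Prod.snd ⁻¹' B : Set ((ι → ℝ) × K)) = Set.univ ×ˢ B := by ext; simp
    rw [h2, ← Measure.prod_restrict, Measure.restrict_univ]
    have h3 := integral_prod_mul (μ := γ) (ν := ν.restrict B) (piChar t) (fun _ => (1 : ℂ))
    simp only [mul_one] at h3
    refine Eq.trans ?_ h3.symm
    rw [h.integral_piChar, integral_const, measureReal_restrict_apply_univ, measureReal_def,
      measureReal_def, hνapp B hB, ← h2, Set.inter_comm]
    simp
  have hνm : ν ≪ m := by
    refine Measure.AbsolutelyContinuous.mk fun B hB hB0 => ?_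
    rw [hνapp B hB]
    refine measure_mono_null Set.inter_subset_left ?_
    rw [measurePreserving_snd.measure_preimage hB.nullMeasurableSet, hB0]
  have hνinv (g : G) (B : Set K) (hB : MeasurableSet B) : ν ((fun k => κ g * k) ⁻¹' B) = ν B := by
    rw [hνapp _ ((measurable_const_mul _) hB), hνapp B hB,
      ← (hT g).measure_preimage ((measurable_snd hB).inter hA).nullMeasurableSet, Set.preimage_inter]
    refine measure_congr ?_
    exact (EventuallyEq.refl _ _).inter (hAinv g).symm
  -- the support of `ν` is invariant, hence trivial
  let B : Set K := {k | ν.rnDeriv m k ≠ 0}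
  have hB : MeasurableSet B := (Measure.measurable_rnDeriv ν m) (measurableSet_singleton 0).compl
  have hνB : ν Bᶜ = 0 := by
    rw [← Measure.withDensity_rnDeriv_eq ν m hνm, withDensity_apply _ hB.compl]
    refine (setLIntegral_congr_fun hB.compl fun k hk => ?_).trans lintegral_zero
    simpa [B] using hk
  have hmB (C : Set K) (hC : MeasurableSet C) (h0 : ν C = 0) : m (C ∩ B) = 0 := by
    rw [← Measure.withDensity_rnDeriv_eq ν m hνm, withDensity_apply _ hC,
      setLIntegral_eq_zero_iff hC (Measure.measurable_rnDeriv ν m)] at h0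
    refine measure_mono_null (fun k hk => ?_) h0
    exact fun h => hk.2 (h hk.1)
  have hBconst : EventuallyConst B (ae m) := by
    have := ergodicSMul_self_of_compactSpace m
    refine aeconst_of_dense_setOfPred_preimage_smul_ae (M := K) hB.nullMeasurableSet
      (hκ.mono ?_)
    rintro _ ⟨g, rfl⟩
    have hm : Measurable fun k => κ g * k := measurable_const_mul _
    have hm' : Measurable fun k => κ g⁻¹ * k := measurable_const_mul _
    have hsub (g : G) : m (B ∩ ((fun k => κ g * k) ⁻¹' B)ᶜ) = 0 := by
      rw [Set.inter_comm]
      refine hmB _ ((measurable_const_mul _) hB).compl ?_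
      rw [← Set.preimage_compl, hνinv g _ hB.compl, hνB]
    change (fun k => κ g * k) ⁻¹' B =ᵐ[m] B
    refine Filter.EventuallyLE.antisymm ?_ ?_
    · rw [ae_le_set]
      have h1 := hsub g⁻¹
      rw [← (measurePreserving_mul_left m (κ g)).measure_preimage
        (hB.inter (hm' hB).compl).nullMeasurableSet] at h1
      refine measure_mono_null (fun k hk => ?_) h1
      exact ⟨hk.1, by simpa using hk.2⟩
    · rw [ae_le_set]
      exact hsub g
  rw [eventuallyConst_set']
  rcases eventuallyConst_set.1 hBconst with h1 | h1
  · right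
    have hmν : m ≪ ν := Measure.AbsolutelyContinuous.mk fun C hC h0 => by
      rw [← measure_inter_add_sdiff C hB, hmB C hC h0, zero_add]
      exact measure_mono_null (fun k hk => hk.2) h1
    have : (γ.prod ν) Aᶜ = 0 := by rw [← heq, Measure.restrict_apply hA.compl]; simp
    rw [ae_eq_univ]
    exact (Measure.AbsolutelyContinuous.rfl.prod hmν) this
  · left
    rw [ae_eq_empty]
    have hν0 : ν Set.univ = 0 := by
      rw [← Set.compl_union_self B]
      refine measure_union_null hνB (hνm ?_)
      simpa [ae_iff] using h1
    rw [hνapp _ .univ] at hν0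
    simpa using hν0

end Ergodic

/-! ### The GNS representation of a positive definite function -/

section GNS

variable {G : Type u} [Group G] {φ : G → ℂ}

open scoped ComplexOrder in
theorem IsPositiveDefiniteFun.sum_nonneg (hφ : IsPositiveDefiniteFun φ) {ι : Type*} (s : Finset ι)
    (c : ι → ℂ) (g : ι → G) : 0 ≤ ∑ x ∈ s, ∑ y ∈ s, c x * conj (c y) * φ (g x * (g y)⁻¹) := by
  have h := hφ s.card (fun i => c (s.equivFin.symm i)) (fun i => g (s.equivFin.symm i))
  rw [← Finset.sum_coe_sort]
  simp_rw [← Finset.sum_coe_sort s (fun y => c _ * conj (c y) * φ (g _ * (g y)⁻¹))]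
  convert! h using 1
  refine (Fintype.sum_equiv s.equivFin.symm _ _ fun i => ?_).symm
  exact Fintype.sum_equiv s.equivFin.symm _ _ fun i => rfl

/-- The sums for the coefficients (1), (1, 1) and (i, 1) have zero imaginary part; the last two give
the imaginary and real parts of the identity. -/
theorem IsPositiveDefiniteFun.map_inv (hφ : IsPositiveDefiniteFun φ) (g : G) :
    φ g⁻¹ = conj (φ g) := by
  have h0 := (Complex.nonneg_iff.1 (hφ 1 ![1] ![1])).2
  have h1 := (Complex.nonneg_iff.1 (hφ 2 ![1, 1] ![g, 1])).2
  have h2 := (Complex.nonneg_iff.1 (hφ 2 ![Complex.I, 1] ![g, 1])).2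
  simp [Fin.sum_univ_two] at h0 h1 h2
  apply Complex.ext
  · simp
    linarith
  · simp
    linarith

/-- The kernel `(g, h) ↦ φ (g⁻¹ h)`. -/
noncomputable def groupKernel (φ : G → ℂ) : Matrix G G (ℂ →L[ℂ] ℂ) :=
  .of fun g h => φ (g⁻¹ * h) • ContinuousLinearMap.id ℂ ℂ

theorem posSemidef_groupKernel (hφ : IsPositiveDefiniteFun φ) : (groupKernel φ).PosSemidef := by
  refine (((RKHS.posSemidef_tfae (K := groupKernel φ)).out 0 2 :) :
    _ ↔ _ ∧ _).2 ⟨?_, fun w => ?_⟩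
  · ext g h
    simp only [groupKernel, Matrix.conjTranspose_apply, Matrix.of_apply, star_smul]
    have : φ (h⁻¹ * g) = conj (φ (g⁻¹ * h)) := by rw [← hφ.map_inv]; simp
    rw [this]
    rw [← ContinuousLinearMap.one_def, star_one]
    simp
  -- Positive definiteness is stated with g h⁻¹ and the kernel with g⁻¹ h, hence the inverted points
  -- and conjugated coefficients.
  · have h := (Complex.nonneg_iff.1 (hφ.sum_nonneg w.support (fun x => conj (w x))
      (fun x => x⁻¹))).1
    simp only [Finsupp.sum, groupKernel, Matrix.of_apply]
    rw [RCLike.re_eq_complex_re, ← Complex.conj_re, map_sum]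
    simp_rw [map_sum]
    rw [Finset.sum_comm]
    refine h.trans_eq (congrArg Complex.re
      (Finset.sum_congr rfl fun x _ => Finset.sum_congr rfl fun y _ => ?_))
    simp
    ring

/-- In the reproducing kernel space of φ(g⁻¹ h), the kernel functions e_g span a dense subspace.
Left translation of the index preserves their Gram matrix and so extends to isometries; the cyclic
vector is e_1. -/
theorem exists_unitary_representation (hφ : IsPositiveDefiniteFun φ) :
    ∃ (H : Type u) (_ : NormedAddCommGroup H) (_ : InnerProductSpace ℂ H) (_ : CompleteSpace H)
      (ρ : G →* (H →L[ℂ] H)) (v : H), (∀ g, star (ρ g) = ρ g⁻¹) ∧ (∀ g, φ g = inner ℂ v (ρ g v)) ∧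
      (Submodule.span ℂ (Set.range fun g => ρ g v)).topologicalClosure = ⊤ := by
  have : Fact (groupKernel φ).PosSemidef := ⟨posSemidef_groupKernel hφ⟩
  let H := RKHS.OfKernel (groupKernel φ)
  let e : G → H := fun g => RKHS.kerFun H g 1
  have he (g h) : inner ℂ (e g) (e h) = φ (g⁻¹ * h) := by
    simp only [e, RKHS.kerFun_inner, RKHS.kerFun_apply, H, RKHS.OfKernel.kernel_ofKernel]
    simp [groupKernel]
  have hspan : (Submodule.span ℂ (Set.range e)).topologicalClosure = ⊤ := by
    rw [eq_top_iff, ← RKHS.kerFun_dense H]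
    refine Submodule.topologicalClosure_mono (Submodule.span_le.2 ?_)
    rintro _ ⟨g, z, rfl⟩
    have : RKHS.kerFun H g z = z • e g := by
      simp only [e]
      rw [← map_smul, smul_eq_mul, mul_one]
    rw [this]
    exact Submodule.smul_mem _ _ (Submodule.subset_span ⟨g, rfl⟩)
  have hU (g : G) := exists_clm_of_inner_eq (𝕜 := ℂ) e (fun h => e (g * h))
    (fun h k => by rw [he, he]; group) hspan
  choose U hUe hUi using hU
  have hext {A B : H →L[ℂ] H} (h : ∀ g, A (e g) = B (e g)) : A = B := by
    refine ContinuousLinearMap.ext_on (s := Set.range e) ?_ ?_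
    · rwa [Submodule.dense_iff_topologicalClosure_eq_top]
    · rintro _ ⟨g, rfl⟩; exact h g
  let ρ : G →* (H →L[ℂ] H) :=
    { toFun := U
      map_one' := hext fun g => by simp [hUe]
      map_mul' := fun g h => hext fun k => by simp [hUe, mul_assoc] }
  have hρ (g) : ρ g = U g := rfl
  have hρe (g) : ρ g (e 1) = e g := by rw [hρ, hUe, mul_one]
  refine ⟨H, inferInstance, inferInstance, inferInstance, ρ, e 1, fun g => ?_, fun g => ?_, ?_⟩
  · rw [ContinuousLinearMap.star_eq_adjoint]
    symm
    rw [ContinuousLinearMap.eq_adjoint_iff]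
    intro x y
    rw [← hUi g, ← hρ, ← mul_apply_eq_comp, ← map_mul]
    simp
  · rw [hρe, he]; simp
  · simp_rw [hρe]; exact hspan

/-- On a sphere, ‖f - a‖² = 2‖a‖² - 2 Re⟨a, f⟩, so weak convergence is norm convergence. -/
theorem tendsto_of_tendsto_inner {H α : Type*} [NormedAddCommGroup H] [InnerProductSpace ℂ H]
    {l : Filter α} {f : α → H} {a : H} (hf : ∀ x, ‖f x‖ = ‖a‖)
    (h : Tendsto (fun x => inner ℂ a (f x)) l (𝓝 (inner ℂ a a))) : Tendsto f l (𝓝 a) := by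
  rw [tendsto_iff_norm_sub_tendsto_zero]
  have h1 (x) : ‖f x - a‖ = √(2 * ‖a‖ ^ 2 - 2 * (inner ℂ a (f x)).re) := by
    rw [← Real.sqrt_sq (norm_nonneg (f x - a)), @norm_sub_sq ℂ, hf, ← inner_conj_symm]
    congr 1
    simp only [RCLike.re_eq_complex_re, Complex.conj_re]
    ring
  simp_rw [h1]
  have h2 := (Complex.continuous_re.tendsto _).comp h
  have h3 := ((h2.const_mul 2).const_sub (2 * ‖a‖ ^ 2)).sqrt
  have h4 : (inner ℂ a a).re = ‖a‖ ^ 2 := by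
    rw [inner_self_eq_norm_sq_to_K]; norm_cast
  rw [h4, sub_self, Real.sqrt_zero] at h3
  exact h3

theorem norm_map_of_star_eq {H : Type*} [NormedAddCommGroup H] [InnerProductSpace ℂ H]
    [CompleteSpace H] {ρ : G →* (H →L[ℂ] H)} (hρ : ∀ g, star (ρ g) = ρ g⁻¹) (g : G) (w : H) :
    ‖ρ g w‖ = ‖w‖ := by
  have h : inner ℂ (ρ g w) (ρ g w) = inner ℂ w w := by
    rw [← ContinuousLinearMap.adjoint_inner_right, ← ContinuousLinearMap.star_eq_adjoint, hρ,
      ← mul_apply_eq_comp, ← map_mul]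
    simp
  rw [@norm_eq_sqrt_re_inner ℂ, h, ← @norm_eq_sqrt_re_inner ℂ]

/-- Orbits have constant norm, so weak continuity of the orbit of v is strong. It extends to the
span, and then to H by uniform approximation, since every ρ g is isometric. -/
theorem continuous_unitary_representation {H : Type*} [NormedAddCommGroup H]
    [InnerProductSpace ℂ H] [CompleteSpace H] [TopologicalSpace G] [IsTopologicalGroup G]
    {ρ : G →* (H →L[ℂ] H)} (hρ : ∀ g, star (ρ g) = ρ g⁻¹) {v : H}
    (hv : (Submodule.span ℂ (Set.range fun g => ρ g v)).topologicalClosure = ⊤)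
    (hc : Continuous fun g => inner ℂ v (ρ g v)) (w : H) : Continuous fun g => ρ g w := by
  have h1 : Continuous fun g => ρ g v := by
    refine continuous_iff_continuousAt.2 fun g₀ => tendsto_of_tendsto_inner
      (fun g => by rw [norm_map_of_star_eq hρ, norm_map_of_star_eq hρ]) ?_
    have h (g) : inner ℂ (ρ g₀ v) (ρ g v) = inner ℂ v (ρ (g₀⁻¹ * g) v) := by
      rw [map_mul, mul_apply_eq_comp, ← hρ, ContinuousLinearMap.star_eq_adjoint,
        ContinuousLinearMap.adjoint_inner_right]
    simp_rw [h]
    exact (hc.comp (continuous_const_mul g₀⁻¹)).tendsto g₀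
  have h2 : ∀ w ∈ Submodule.span ℂ (Set.range fun g => ρ g v), Continuous fun g => ρ g w := by
    intro w hw
    induction hw using Submodule.span_induction with
    | mem w hw =>
      obtain ⟨h, rfl⟩ := hw
      simp only [← mul_apply_eq_comp, ← map_mul]
      exact h1.comp (continuous_mul_const h)
    | zero => simpa using continuous_const
    | add x y _ _ hx hy => simp only [map_add]; exact hx.add hy
    | smul c x _ hx => simp only [map_smul]; exact hx.const_smul c
  have hw : w ∈ (Submodule.span ℂ (Set.range fun g => ρ g v)).topologicalClosure := by
    rw [hv]; trivial
  refine continuous_of_uniform_approx_of_continuous fun U hU => ?_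
  obtain ⟨ε, hε, hεU⟩ := Metric.mem_uniformity_dist.1 hU
  obtain ⟨w', hw', hd⟩ := Metric.mem_closure_iff.1 hw ε hε
  refine ⟨_, h2 w' hw', fun g => hεU ?_⟩
  rwa [dist_eq_norm, ← map_sub, norm_map_of_star_eq hρ, ← dist_eq_norm]

end GNS

/-! ### Compact operator semigroups and the de Leeuw–Glicksberg splitting -/

/-- A compact right topological semigroup has a minimal idempotent. -/
theorem exists_minimal_idempotent {M : Type*} [Semigroup M] [TopologicalSpace M] [T2Space M]
    (hc : ∀ r : M, Continuous (· * r)) {S : Set M} (hne : S.Nonempty) (hS : IsCompact S)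
    (hmul : ∀ᵉ (x ∈ S) (y ∈ S), x * y ∈ S) :
    ∃ p ∈ S, p * p = p ∧ ∀ q ∈ S, q * q = q → p * q = q → q * p = q → q = p := by
  -- Closed nonempty left ideals of S; an idempotent of a minimal one is a minimal idempotent.
  let 𝓛 : Set (Set M) := {L | IsClosed L ∧ L.Nonempty ∧ L ⊆ S ∧ ∀ s ∈ S, ∀ x ∈ L, s * x ∈ L}
  obtain ⟨L, -, hL⟩ : ∃ L, L ⊆ S ∧ Minimal (· ∈ 𝓛) L := by
    refine zorn_superset_nonempty 𝓛 (fun c hcs hch hcne => ?_) S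
      ⟨hS.isClosed, hne, subset_rfl, hmul⟩
    refine ⟨⋂₀ c, ⟨isClosed_sInter fun t ht => (hcs ht).1, ?_, ?_, ?_⟩,
      fun s hs => Set.sInter_subset_of_mem hs⟩
    · have := hcne.to_subtype
      rw [Set.sInter_eq_iInter]
      exact IsCompact.nonempty_iInter_of_directed_nonempty_isCompact_isClosed _
        (DirectedOn.directed_val (IsChain.directedOn hch.symm)) (fun t => (hcs t.2).2.1)
        (fun t => hS.of_isClosed_subset (hcs t.2).1 (hcs t.2).2.2.1) (fun t => (hcs t.2).1)
    · obtain ⟨t, ht⟩ := hcne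
      exact (Set.sInter_subset_of_mem ht).trans (hcs ht).2.2.1
    · exact fun s hs x hx t ht => (hcs ht).2.2.2 s hs x (hx t ht)
  obtain ⟨hLc, hLne, hLS, hLi⟩ := hL.prop
  obtain ⟨p, hp, hpp⟩ := exists_idempotent_in_compact_subsemigroup hc L hLne
    (hS.of_isClosed_subset hLc hLS) fun x hx y hy => hLi x (hLS hx) y hy
  refine ⟨p, hLS hp, hpp, fun q hq hqq hpq hqp => ?_⟩
  have hqL : q ∈ L := hqp ▸ hLi q hq p hp
  -- Sq is a closed left ideal inside L, so minimality gives p = tq for some t; then pq = p, while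
  -- pq = q by assumption.
  have himg : (· * q) '' S = L := by
    refine hL.eq_of_subset ⟨(hS.image (hc q)).isClosed, hne.image _, ?_, ?_⟩ ?_
    · rintro _ ⟨s, hs, rfl⟩; exact hmul s hs q hq
    · rintro t ht _ ⟨s, hs, rfl⟩
      exact ⟨t * s, hmul t ht s hs, mul_assoc _ _ _⟩
    · rintro _ ⟨s, hs, rfl⟩; exact hLi s hs q hqL
  rw [← himg] at hp
  obtain ⟨t, -, rfl⟩ := hp
  simp only [mul_assoc, hqq] at hpq
  exact hpq.symm

section WOT

variable {H : Type*} [NormedAddCommGroup H] [InnerProductSpace ℂ H] [CompleteSpace H]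

open ContinuousLinearMapWOT

/-- The unit ball of the bounded operators on a Hilbert space is compact in the weak operator
topology. -/
theorem isCompact_contractions :
    IsCompact {T : H →WOT[ℂ] H | ∀ x, ‖T x‖ ≤ ‖x‖} := by
  rw [isCompact_iff_ultrafilter_le_nhds]
  intro f hf
  rw [le_principal_iff] at hf
  -- Along an ultrafilter each ⟨Tx, y⟩ stays in a compact disc and so converges. The limits form a
  -- bounded sesquilinear form, which is represented by the limit operator.
  have hlim (x y : H) : ∃ z ∈ Metric.closedBall (0 : ℂ) (‖x‖ * ‖y‖),
      Tendsto (fun T : H →WOT[ℂ] H => inner ℂ (T x) y) f (𝓝 z) := by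
    have hK := (isCompact_closedBall (0 : ℂ) (‖x‖ * ‖y‖)).ultrafilter_le_nhds
      (f.map fun T : H →WOT[ℂ] H => inner ℂ (T x) y) (by
        rw [le_principal_iff, Ultrafilter.mem_coe, Ultrafilter.mem_map]
        refine mem_of_superset hf fun T hT => ?_
        rw [Set.mem_preimage, mem_closedBall_zero_iff]
        exact (norm_inner_le_norm _ _).trans (by gcongr; exact hT x))
    exact hK
  choose B hB hBlim using hlim
  let Bl : H →L⋆[ℂ] H →L[ℂ] ℂ := LinearMap.mkContinuous₂
    (LinearMap.mk₂'ₛₗ (starRingEnd ℂ) (RingHom.id ℂ) B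
      (fun x x' y => tendsto_nhds_unique (hBlim _ _) (by
        simpa [inner_add_left] using (hBlim x y).add (hBlim x' y)))
      (fun c x y => tendsto_nhds_unique (hBlim _ _) (by
        simpa [inner_smul_left, mul_comm] using (hBlim x y).const_mul (conj c)))
      (fun x y y' => tendsto_nhds_unique (hBlim _ _) (by
        simpa [inner_add_right] using (hBlim x y).add (hBlim x y')))
      (fun c x y => tendsto_nhds_unique (hBlim _ _) (by
        simpa [inner_smul_right, mul_comm] using (hBlim x y).const_mul c)))
    1 fun x y => by simpa using hB x y
  let A : H →WOT[ℂ] H := .ofCLM (InnerProductSpace.continuousLinearMapOfBilin Bl)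
  have hA (x y) : inner ℂ (A x) y = B x y :=
    InnerProductSpace.continuousLinearMapOfBilin_apply Bl x y
  have htend : (f : Filter (H →WOT[ℂ] H)) ≤ 𝓝 A := by
    refine tendsto_iff_forall_inner_apply_tendsto.2 fun x y => ?_
    have := (Complex.continuous_conj.tendsto _).comp (hBlim x y)
    rw [← hA] at this
    simpa [Function.comp_def] using this
  refine ⟨A, fun x => ?_, htend⟩
  have h1 : ‖inner ℂ (A x) (A x)‖ ≤ ‖x‖ * ‖A x‖ := by
    rw [hA]; simpa using hB x (A x)
  rw [inner_self_eq_norm_sq_to_K, norm_pow, RCLike.norm_ofReal, abs_norm, sq] at h1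
  rcases (norm_nonneg (A x)).eq_or_lt with h0 | h0
  · rw [← h0]; exact norm_nonneg x
  · exact le_of_mul_le_mul_right h1 h0

end WOT

section JdLG

variable {H : Type u} [NormedAddCommGroup H] [InnerProductSpace ℂ H]

open ContinuousLinearMapWOT

theorem wot_mul_apply (S T : H →WOT[ℂ] H) (x : H) : (S * T) x = S (T x) := rfl

theorem re_inner_self_eq (x : H) : (inner ℂ x x).re = ‖x‖ ^ 2 := by
  rw [inner_self_eq_norm_sq_to_K]; norm_cast

theorem ext_of_inner_self {S T : H →WOT[ℂ] H} (h : ∀ x, inner ℂ (S x) x = inner ℂ (T x) x) :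
    S = T := by
  have := (ext_inner_map S.toCLM.toLinearMap T.toCLM.toLinearMap).1 h
  exact ContinuousLinearMapWOT.ext fun x => LinearMap.congr_fun this x

variable [CompleteSpace H]

theorem inner_star_apply (T : H →WOT[ℂ] H) (x y : H) :
    inner ℂ (star T x) y = inner ℂ x (T y) := by
  rw [star_apply, ContinuousLinearMap.star_eq_adjoint]
  exact ContinuousLinearMap.adjoint_inner_left _ _ _

theorem inner_apply_star (T : H →WOT[ℂ] H) (x y : H) :
    inner ℂ x (star T y) = inner ℂ (T x) y := by
  rw [← inner_star_apply, star_star]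

theorem star_mul_self_eq_of_norm_eq {T P : H →WOT[ℂ] H} (hP : star P * P = P)
    (h : ∀ x, ‖T x‖ = ‖P x‖) : star T * T = P := by
  rw [← hP]
  refine ext_of_inner_self fun x => ?_
  rw [wot_mul_apply, wot_mul_apply, inner_star_apply, inner_star_apply,
    inner_self_eq_norm_sq_to_K, inner_self_eq_norm_sq_to_K, h]

/-- An idempotent contraction of a Hilbert space is an orthogonal projection. -/
theorem star_eq_of_idempotent_of_contraction {P : H →WOT[ℂ] H} (hP : P * P = P)
    (hs : ∀ x, ‖star P x‖ ≤ ‖x‖) : star P = P := by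
  have h1 : star P * P = P := by
    refine ContinuousLinearMapWOT.ext fun x => ?_
    have hx : P (P x) = P x := congrArg (fun T : H →WOT[ℂ] H => T x) hP
    -- Expand the square: ⟨P*Px, Px⟩ = ⟨Px, PPx⟩ = ‖Px‖², and ‖P*Px‖ ≤ ‖Px‖.
    have h2 : ‖star P (P x) - P x‖ ^ 2 ≤ 0 := by
      rw [@norm_sub_sq ℂ, inner_star_apply, hx, RCLike.re_eq_complex_re, re_inner_self_eq]
      have := pow_le_pow_left₀ (norm_nonneg _) (hs (P x)) 2
      linarith
    have h3 : ‖star P (P x) - P x‖ = 0 := by nlinarith [norm_nonneg (star P (P x) - P x)]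
    exact sub_eq_zero.1 (norm_eq_zero.1 h3)
  rw [← h1, star_mul, star_star, h1]

/-- Take a minimal idempotent P. For T with PT = T = TP, the closed semigroup generated by A = T*T
contains an idempotent, which lies below P and so equals P. Since ⟨x, Bx⟩ has real part at most
‖Tx‖² for every B in it, ‖Px‖ ≤ ‖Tx‖. Hence T is isometric on the range of P, and T* is its inverse
there. -/
theorem exists_projection_of_compact_semigroup {S : Set (H →WOT[ℂ] H)} (hS : IsCompact S)
    (h1 : 1 ∈ S) (hmul : ∀ᵉ (x ∈ S) (y ∈ S), x * y ∈ S) (hstar : ∀ x ∈ S, star x ∈ S)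
    (hcontr : ∀ T ∈ S, ∀ x, ‖T x‖ ≤ ‖x‖) :
    ∃ P ∈ S, P * P = P ∧ star P = P ∧ ∀ T ∈ S, P * T = T → T * P = T → star T * T = P := by
  obtain ⟨P, hPS, hPP, hmin⟩ := exists_minimal_idempotent
    (fun r : H →WOT[ℂ] H => continuous_mul_const r) ⟨1, h1⟩ hS hmul
  have hPs : star P = P := star_eq_of_idempotent_of_contraction hPP
    (hcontr _ (hstar P hPS))
  refine ⟨P, hPS, hPP, hPs, fun T hTS hPT hTP => ?_⟩
  have hpow : ∀ A ∈ S, ∀ n : ℕ, A ^ n ∈ S := fun A hA n => by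
    induction n with
    | zero => simpa using h1
    | succ n ih => rw [pow_succ]; exact hmul _ ih _ hA
  set A := star T * T with hA
  have hAS : A ∈ S := hmul _ (hstar T hTS) _ hTS
  have hPA : P * A = A := by
    have : P * star T = star T := by rw [← hPs, ← star_mul, hTP]
    rw [hA, ← mul_assoc, this]
  have hAP : A * P = A := by rw [hA, mul_assoc, hTP]
  let C : Set (H →WOT[ℂ] H) := closure (Set.range fun n : ℕ => A ^ (n + 1))
  have hCsub {D : Set (H →WOT[ℂ] H)} (hD : IsClosed D) (h : ∀ n : ℕ, A ^ (n + 1) ∈ D) : C ⊆ D :=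
    closure_minimal (by rintro _ ⟨n, rfl⟩; exact h n) hD
  have hCS : C ⊆ S := hCsub hS.isClosed fun n => hpow A hAS _
  have hCmul : ∀ᵉ (x ∈ C) (y ∈ C), x * y ∈ C := by
    have hstep (n : ℕ) : ∀ y ∈ C, A ^ (n + 1) * y ∈ C := fun y hy =>
      map_mem_closure (continuous_const_mul _) hy (by
        rintro _ ⟨k, rfl⟩
        exact ⟨n + k + 1, by simp only [← pow_add]; congr 1; ring⟩)
    intro x hx y hy
    have : x * y ∈ closure C := map_mem_closure (f := (· * y)) (continuous_mul_const y) hx (by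
      rintro _ ⟨n, rfl⟩
      exact hstep n y hy)
    rwa [isClosed_closure.closure_eq] at this
  obtain ⟨Q, hQC, hQQ⟩ := exists_idempotent_in_compact_subsemigroup
    (fun r : H →WOT[ℂ] H => continuous_mul_const r) C ⟨_, subset_closure ⟨0, rfl⟩⟩
    (hS.of_isClosed_subset isClosed_closure hCS) hCmul
  have hQP : Q = P := hmin Q (hCS hQC) hQQ
    (hCsub (D := {B | P * B = B}) (isClosed_eq (continuous_const_mul _) continuous_id)
      (fun n => by rw [Set.mem_ofPred_eq, pow_succ', ← mul_assoc, hPA]) hQC)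
    (hCsub (D := {B | B * P = B}) (isClosed_eq (continuous_mul_const _) continuous_id)
      (fun n => by rw [Set.mem_ofPred_eq, pow_succ, mul_assoc, hAP]) hQC)
  refine star_mul_self_eq_of_norm_eq (by rw [hPs, hPP]) fun x => ?_
  refine le_antisymm ?_ ?_
  · rw [← hTP]
    exact hcontr T hTS (P x)
  · have hle : ∀ B ∈ C, (inner ℂ x (B x)).re ≤ ‖T x‖ ^ 2 := by
      refine hCsub (D := {B | (inner ℂ x (B x)).re ≤ ‖T x‖ ^ 2})
        (isClosed_le (Complex.continuous_re.comp (continuous_inner_apply continuous_id x x))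
          continuous_const) fun n => ?_
      -- This form leaves a T at each end and a contraction between, which gives the bound ‖Tx‖². It
      -- needs exponents from 1 on, so the semigroup must omit A⁰.
      have hshift : A ^ (n + 1) = star T * (T * star T) ^ n * T := by
        induction n with
        | zero => simp [hA]
        | succ n ih => rw [pow_succ, ih, pow_succ _ n, hA]; simp only [mul_assoc]
      rw [Set.mem_ofPred_eq, hshift, wot_mul_apply, wot_mul_apply, inner_apply_star]
      calc _ ≤ ‖inner ℂ (T x) (((T * star T) ^ n) (T x))‖ := Complex.re_le_norm _
        _ ≤ ‖T x‖ * ‖T x‖ := (norm_inner_le_norm _ _).trans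
          (by gcongr; exact hcontr _ (hpow _ (hmul _ hTS _ (hstar _ hTS)) n) _)
        _ = ‖T x‖ ^ 2 := (sq _).symm
    have h2 := hle P (hQP ▸ hQC)
    rw [← hPP, wot_mul_apply] at h2
    nth_rw 1 [← hPs] at h2
    rw [inner_apply_star, re_inner_self_eq] at h2
    exact le_of_sq_le_sq h2 (norm_nonneg _)

/-- Compressing U to the range of P loses no norm, so U maps that range into itself. -/
theorem commute_of_norm_mul_eq {P U : H →WOT[ℂ] H} (hPP : P * P = P) (hPs : star P = P)
    (hU : star U * U = 1) (h1 : star (P * U * P) * (P * U * P) = P) : P * U * P = U * P := by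
  have h2 : star (P * U * P - U * P) * (P * U * P - U * P) = 0 := by
    have hPP' (X : H →WOT[ℂ] H) : P * (P * X) = P * X := by rw [← mul_assoc, hPP]
    have hU' (X : H →WOT[ℂ] H) : star U * (U * X) = X := by rw [← mul_assoc, hU, one_mul]
    simp only [star_mul, hPs, mul_assoc, hPP'] at h1
    simp only [star_sub, star_mul, hPs, mul_sub, sub_mul, mul_assoc, hPP', hU', h1, hPP]
    simp
  refine ContinuousLinearMapWOT.ext fun x => ?_
  have h3 : inner ℂ ((P * U * P - U * P) x) ((P * U * P - U * P) x) = 0 := by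
    rw [← inner_apply_star, ← wot_mul_apply, h2]
    simp
  have := inner_self_eq_zero.1 h3
  exact sub_eq_zero.1 this

end JdLG

open ContinuousLinearMapWOT in
/-- The de Leeuw–Glicksberg decomposition of a unitary representation `ρ` on a Hilbert space: there
is an equivariant projection `P`, a weak limit of operators `ρ g`, such that `ρ` restricted to the
range of `P` factors through a homomorphism to a compact group with dense range. -/
theorem exists_compact_part {G : Type v} [Group G] [TopologicalSpace G] {H : Type u}
    [NormedAddCommGroup H] [InnerProductSpace ℂ H] [CompleteSpace H]
    {ρ : G →* (H →L[ℂ] H)} (hρ : ∀ g, star (ρ g) = ρ g⁻¹) (hρc : ∀ x, Continuous fun g => ρ g x) :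
    ∃ (K : Type u) (_ : Group K) (_ : TopologicalSpace K) (_ : IsTopologicalGroup K)
      (_ : CompactSpace K) (_ : T2Space K) (κ : G →* K) (τ : K → H →L[ℂ] H) (P : H →L[ℂ] H)
      (l : Filter G), l.NeBot ∧ DenseRange κ ∧ Continuous κ ∧
      (∀ k k', τ (k * k') = τ k * τ k') ∧ (∀ k, star (τ k) = τ k⁻¹) ∧ τ 1 = P ∧
      (∀ g, τ (κ g) = ρ g * P) ∧ (∀ g, P * ρ g = ρ g * P) ∧
      (∀ x y, Continuous fun k => inner ℂ x (τ k y)) ∧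
      ∀ x y, Tendsto (fun g => inner ℂ x (ρ g y)) l (𝓝 (inner ℂ x (P y))) := by
  let r : G → (H →WOT[ℂ] H) := fun g => ofCLM (ρ g)
  have hr1 : r 1 = 1 := by simp only [r, map_one]; rfl
  have hrmul (g h) : r (g * h) = r g * r h := by simp only [r, map_mul]; rfl
  have hrstar (g) : star (r g) = r g⁻¹ := by simp only [r, ← hρ]; rfl
  have hrr (g) : star (r g) * r g = 1 := by rw [hrstar, ← hrmul, inv_mul_cancel, hr1]
  let S : Set (H →WOT[ℂ] H) := closure (Set.range r)
  have hrS (g) : r g ∈ S := subset_closure ⟨g, rfl⟩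
  have hSball : S ⊆ {T | ∀ x, ‖T x‖ ≤ ‖x‖} := closure_minimal
    (by rintro _ ⟨g, rfl⟩ x; exact (norm_map_of_star_eq hρ g x).le) isCompact_contractions.isClosed
  have hS : IsCompact S := isCompact_contractions.of_isClosed_subset isClosed_closure hSball
  have h1 : 1 ∈ S := hr1 ▸ hrS 1
  have hmul : ∀ᵉ (x ∈ S) (y ∈ S), x * y ∈ S := by
    have hstep (g : G) : ∀ y ∈ S, r g * y ∈ S := fun y hy =>
      map_mem_closure (continuous_const_mul _) hy (by
        rintro _ ⟨k, rfl⟩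
        exact ⟨g * k, hrmul g k⟩)
    intro x hx y hy
    have : x * y ∈ closure S := map_mem_closure (f := (· * y)) (continuous_mul_const y) hx (by
      rintro _ ⟨g, rfl⟩
      exact hstep g y hy)
    rwa [isClosed_closure.closure_eq] at this
  have hstar : ∀ x ∈ S, star x ∈ S := fun x hx => map_mem_closure continuous_star hx (by
    rintro _ ⟨g, rfl⟩
    exact ⟨g⁻¹, (hrstar g).symm⟩)
  obtain ⟨P, hPS, hPP, hPs, hP⟩ := exists_projection_of_compact_semigroup hS h1 hmul hstar
    fun T hT => hSball hT
  have hPr (g) : P * r g * P = r g * P := by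
    refine commute_of_norm_mul_eq hPP hPs (hrr g) (hP _ (hmul _ (hmul _ hPS _ (hrS g)) _ hPS) ?_ ?_)
    · simp only [← mul_assoc, hPP]
    · simp only [mul_assoc, hPP]
  -- Invariance of the range of P under g⁻¹ becomes, after taking adjoints, invariance of its
  -- orthogonal complement under g.
  have hcomm (g) : P * r g = r g * P := by
    have h := congrArg star (hPr g⁻¹)
    simp only [star_mul, hPs, hrstar, inv_inv] at h
    rw [← h, ← mul_assoc, hPr]
  -- The compact group: its unit is P, and by `hP` the inverse is the adjoint.
  let Kset : Set (H →WOT[ℂ] H) := {T | T ∈ S ∧ P * T = T ∧ T * P = T}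
  have hKS : IsCompact Kset := hS.inter_right
    ((isClosed_eq (continuous_const_mul P) continuous_id).inter
      (isClosed_eq (continuous_mul_const P) continuous_id))
  have hKstar {T} (hT : T ∈ Kset) : star T ∈ Kset := ⟨hstar _ hT.1,
    by rw [← hPs, ← star_mul, hT.2.2], by rw [← hPs, ← star_mul, hT.2.1]⟩
  let K : Type u := Kset
  let iMul : Mul K := ⟨fun a b => ⟨a.1 * b.1, hmul _ a.2.1 _ b.2.1, by rw [← mul_assoc, a.2.2.1],
    by rw [mul_assoc, b.2.2.2]⟩⟩
  let iOne : One K := ⟨⟨P, hPS, hPP, hPP⟩⟩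
  let iInv : Inv K := ⟨fun a => ⟨star a.1, hKstar a.2⟩⟩
  let iG : Group K := Group.ofLeftAxioms (fun a b c => Subtype.ext (mul_assoc a.1 b.1 c.1))
    (fun a => Subtype.ext a.2.2.1) (fun a => Subtype.ext (hP a.1 a.2.1 a.2.2.1 a.2.2.2))
  have hKmul (a b : K) : (a * b).1 = a.1 * b.1 := rfl
  have hKinv (a : K) : (a⁻¹).1 = star a.1 := rfl
  let iT : TopologicalSpace K := instTopologicalSpaceSubtype
  have hnorm (a : K) (x : H) : ‖a.1 x‖ = ‖P x‖ := by
    have h : inner ℂ (a.1 x) (a.1 x) = inner ℂ (P x) (P x) := by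
      rw [← inner_star_apply, ← inner_star_apply, ← wot_mul_apply, ← wot_mul_apply,
        hP a.1 a.2.1 a.2.2.1 a.2.2.2, hPs, hPP]
    rw [@norm_eq_sqrt_re_inner ℂ, h, ← @norm_eq_sqrt_re_inner ℂ]
  have hweak (x y : H) : Continuous fun k : K => inner ℂ x (k.1 y) :=
    continuous_inner_apply continuous_subtype_val y x
  -- Operator multiplication is only separately continuous in the weak topology. On K the norms ‖kx‖
  -- are constant in k, so the weak and strong topologies agree and multiplication becomes jointly
  -- continuous.
  have hstrong (x : H) : Continuous fun k : K => k.1 x :=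
    continuous_iff_continuousAt.2 fun k => tendsto_of_tendsto_inner
      (fun k' => by rw [hnorm, hnorm]) (hweak _ x).continuousAt
  have hinv : Continuous fun k : K => k⁻¹ :=
    continuous_induced_rng.2 (continuous_star.comp continuous_subtype_val)
  have hTG : IsTopologicalGroup K := {
    continuous_mul := continuous_induced_rng.2 (by
      refine ContinuousLinearMapWOT.continuous_iff.2 fun x y => ?_
      have h (p : K × K) : inner ℂ y ((p.1 * p.2).1 x) = inner ℂ ((p.1⁻¹).1 y) (p.2.1 x) := by
        rw [hKmul, wot_mul_apply, hKinv, inner_star_apply]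
      simp only [Function.comp_def, h]
      exact (((hstrong y).comp hinv).comp continuous_fst).inner ((hstrong x).comp continuous_snd))
    continuous_inv := hinv }
  have hPr' (g) : P * (r g * P) = r g * P := by rw [← mul_assoc, hPr]
  let κ : G →* K := {
    toFun g := ⟨r g * P, hmul _ (hrS g) _ hPS, hPr' g, by rw [mul_assoc, hPP]⟩
    map_one' := Subtype.ext (show r 1 * P = P by rw [hr1, one_mul])
    map_mul' g h := Subtype.ext (show r (g * h) * P = r g * P * (r h * P) by
      rw [mul_assoc (r g) P, hPr', ← mul_assoc, hrmul]) }
  -- The filter l consists of the g with ρ g weakly near P; it is nontrivial since P lies in the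
  -- closure of ρ(G).
  have hNB : (comap r (𝓝 P)).NeBot := comap_neBot_iff.2 fun t ht => by
    obtain ⟨_, h1, g, rfl⟩ := mem_closure_iff_nhds.1 hPS t ht
    exact ⟨g, h1⟩
  refine ⟨K, iG, iT, hTG, isCompact_iff_compactSpace.1 hKS, inferInstanceAs (T2Space Kset), κ,
    fun k => toCLM k.1, toCLM P, comap r (𝓝 P), hNB, fun k => ?_, ?_, fun _ _ => rfl,
    fun _ => rfl, rfl, fun _ => rfl, fun g => congrArg toCLM (hcomm g), hweak, fun x y =>
    ContinuousLinearMapWOT.tendsto_iff_forall_inner_apply_tendsto.1 tendsto_comap y x⟩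
  -- An element k of K is a weak limit of operators r g, so k = kP is a limit of r g * P = κ g.
  · refine closure_subtype.2 ?_
    have : k.1 * P ∈ closure (Subtype.val '' Set.range κ) :=
      map_mem_closure (f := (· * P)) (continuous_mul_const P) k.2.1 (by
        rintro _ ⟨g, rfl⟩
        exact ⟨κ g, ⟨g, rfl⟩, rfl⟩)
    rwa [k.2.2.2] at this
  · exact continuous_induced_rng.2 (ContinuousLinearMapWOT.continuous_iff.2 fun x y =>
      continuous_const.inner (hρc (P x)))

/-! ### Polar decomposition relative to a closed real subspace -/

section Polar

variable {H L : Type*} [NormedAddCommGroup H] [InnerProductSpace ℂ H] [CompleteSpace H]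
  [NormedAddCommGroup L] [InnerProductSpace ℂ L] [CompleteSpace L]

/-- The positive square root of `J† J`, with the properties it shares with `J† J`. -/
theorem exists_sqrt_adjoint_comp_self (J : H →L[ℂ] L) :
    ∃ S : H →L[ℂ] H, (∀ x y, inner ℂ (S x) (S y) = inner ℂ (J x) (J y)) ∧
      (∀ x y, inner ℂ (S x) y = inner ℂ x (S y)) ∧
      (∀ T : H →L[ℂ] H, Commute (ContinuousLinearMap.adjoint J ∘L J) T → Commute S T) ∧
      ∀ E : Submodule ℝ H, IsClosed (E : Set H) →
        (∀ x ∈ E, (ContinuousLinearMap.adjoint J ∘L J) x ∈ E) → ∀ x ∈ E, S x ∈ E := by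
  set A : H →L[ℂ] H := ContinuousLinearMap.adjoint J ∘L J with hA
  have hA0 : 0 ≤ A := (ContinuousLinearMap.nonneg_iff_isPositive _).2
    (ContinuousLinearMap.isPositive_adjoint_comp_self J)
  have hAs : IsSelfAdjoint A := .of_nonneg hA0
  have hSS : cfc Real.sqrt A * cfc Real.sqrt A = A := by
    rw [← cfc_mul _ _ A]
    conv_rhs => rw [← cfc_id ℝ A]
    exact cfc_congr fun x hx => Real.mul_self_sqrt (spectrum_nonneg_of_nonneg hA0 hx)
  have hSs : IsSelfAdjoint (cfc Real.sqrt A) := cfc_predicate _ _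
  have hsymm (x y) : inner ℂ (cfc Real.sqrt A x) y = inner ℂ x (cfc Real.sqrt A y) := by
    rw [← ContinuousLinearMap.adjoint_inner_right, ← ContinuousLinearMap.star_eq_adjoint,
      hSs.star_eq]
  refine ⟨cfc Real.sqrt A, fun x y => ?_, hsymm, fun T hT => (hAs.commute_cfc hT _), ?_⟩
  · rw [hsymm, ← mul_apply_eq_comp, hSS, hA, ContinuousLinearMap.comp_apply,
      ContinuousLinearMap.adjoint_inner_right]
  · intro E hE hAE
    -- Operators that preserve E together with their adjoints form a closed real star algebra, hence
    -- one stable under the real functional calculus. Real scalars are essential: E will encode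
    -- real-valuedness.
    let D : StarSubalgebra ℝ (H →L[ℂ] H) := {
      carrier := {T | (∀ x ∈ E, T x ∈ E) ∧ ∀ x ∈ E, (star T) x ∈ E}
      mul_mem' := fun {S T} hS hT => ⟨fun x hx => hS.1 _ (hT.1 x hx),
        fun x hx => by rw [star_mul]; exact hT.2 _ (hS.2 x hx)⟩
      add_mem' := fun {S T} hS hT => ⟨fun x hx => E.add_mem (hS.1 x hx) (hT.1 x hx),
        fun x hx => by rw [star_add]; exact E.add_mem (hS.2 x hx) (hT.2 x hx)⟩
      algebraMap_mem' := fun c => by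
        rw [Algebra.algebraMap_eq_smul_one]
        exact ⟨fun x hx => E.smul_mem c hx, fun x hx => by
          rw [star_smul, star_one]; exact E.smul_mem c hx⟩
      star_mem' := fun {T} hT => ⟨hT.2, by rw [star_star]; exact hT.1⟩ }
    have hD : IsClosed (D : Set (H →L[ℂ] H)) := by
      have h (x : H) (hx : x ∈ E) : IsClosed {T : H →L[ℂ] H | T x ∈ E} :=
        hE.preimage (ContinuousLinearMap.apply ℂ H x).continuous
      have h' (x : H) (hx : x ∈ E) : IsClosed {T : H →L[ℂ] H | (star T) x ∈ E} :=
        (h x hx).preimage continuous_star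
      have : (D : Set (H →L[ℂ] H)) = (⋂ x ∈ E, {T : H →L[ℂ] H | T x ∈ E}) ∩
          ⋂ x ∈ E, {T : H →L[ℂ] H | (star T) x ∈ E} := by
        ext T
        simp only [Set.mem_inter_iff, Set.mem_iInter]
        rfl
      rw [this]
      exact (isClosed_biInter h).inter (isClosed_biInter h')
    have hAD : A ∈ D := ⟨hAE, by rw [hAs.star_eq]; exact hAE⟩
    exact (cfc_mem (s := D) (hs := hD) Real.sqrt hAD).1

/-- Let p be the real orthogonal projection of v to the closure of S(E). The residual v - p stays in
E and is orthogonal to S²(v - p), so S kills it. By `h0` it is then orthogonal to v as well as to p,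
hence zero. -/
theorem mem_closure_image_of_symmetric {S : H →L[ℂ] H}
    (hS : ∀ x y, inner ℂ (S x) y = inner ℂ x (S y)) {E : Submodule ℝ H}
    (hE : IsClosed (E : Set H)) (hSE : ∀ x ∈ E, S x ∈ E) {v : H} (hv : v ∈ E)
    (h0 : ∀ w, S w = 0 → inner ℂ w v = 0) : v ∈ closure (S '' E) := by
  let F : Submodule ℝ H := (E.map (S.restrictScalars ℝ).toLinearMap).topologicalClosure
  have hFE : F ≤ E := Submodule.topologicalClosure_minimal _
    (by rintro _ ⟨x, hx, rfl⟩; exact hSE x hx) hE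
  have : CompleteSpace F := (Submodule.isClosed_topologicalClosure _).completeSpace_coe
  let _ : InnerProductSpace ℝ H := InnerProductSpace.complexToReal
  let p : H := Submodule.starProjection (𝕜 := ℝ) F v
  have hpF : p ∈ F := Submodule.starProjection_apply_mem (𝕜 := ℝ) F v
  have horth : ∀ x ∈ F, inner ℝ (v - p) x = 0 := 
    fun x hx => Submodule.starProjection_inner_eq_zero (𝕜 := ℝ) v x hx
  have hw : v - p ∈ E := E.sub_mem hv (hFE hpF)
  have hSw : S (v - p) = 0 := by
    have h1 := horth (S (S (v - p)))
      (Submodule.le_topologicalClosure _ ⟨_, hSE _ hw, rfl⟩)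
    rw [real_inner_eq_re_inner ℂ, ← hS, RCLike.re_eq_complex_re, re_inner_self_eq] at h1
    exact norm_eq_zero.1 (pow_eq_zero_iff two_ne_zero |>.1 h1)
  have h2 : inner ℝ (v - p) (v - p) = 0 := by
    rw [inner_sub_right, horth p hpF, real_inner_eq_re_inner ℂ, h0 _ hSw]
    simp
  have h3 : v = p := sub_eq_zero.1 (inner_self_eq_zero.1 h2)
  have : v ∈ F := h3 ▸ hpF
  exact this

/-- The isometry in the polar decomposition of `J`, evaluated at a vector orthogonal to the kernel
of `J`. -/
theorem exists_mem_closure_image_inner_eq (J : H →L[ℂ] L) {E : Submodule ℝ H}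
    (hE : IsClosed (E : Set H)) (hJE : ∀ x ∈ E, (ContinuousLinearMap.adjoint J ∘L J) x ∈ E) {v : H}
    (hv : v ∈ E) (h0 : ∀ w, J w = 0 → inner ℂ w v = 0) :
    ∃ f ∈ closure (J '' E), ∀ (T : H →L[ℂ] H) (U : L → L), Continuous U →
      (∀ x, U (J x) = J (T x)) → Commute (ContinuousLinearMap.adjoint J ∘L J) T →
        inner ℂ f (U f) = inner ℂ v (T v) := by
  obtain ⟨S, hSJ, hS, hSc, hSE⟩ := exists_sqrt_adjoint_comp_self J
  have hnorm (x) : ‖J x‖ = ‖S x‖ := by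
    rw [@norm_eq_sqrt_re_inner ℂ, ← hSJ, ← @norm_eq_sqrt_re_inner ℂ]
  obtain ⟨y, hy, hyv⟩ := mem_closure_iff_seq_limit.1 (mem_closure_image_of_symmetric hS hE
    (hSE E hE hJE) hv fun w hw => h0 w (norm_eq_zero.1 (by rw [hnorm, hw, norm_zero])))
  choose w hwE hwy using hy
  -- Since ‖Jw‖ = ‖Sw‖, convergence of S(w n) to v forces J(w n) to converge; the limit is the image
  -- of v under the isometry Sw ↦ Jw.
  have hcau : CauchySeq fun n => J (w n) := by
    have := hyv.cauchySeq
    rw [Metric.cauchySeq_iff] at this ⊢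
    intro ε hε
    obtain ⟨N, hN⟩ := this ε hε
    refine ⟨N, fun m hm n hn => ?_⟩
    have h1 := hN m hm n hn
    rwa [← hwy, ← hwy, dist_eq_norm, ← map_sub, ← hnorm, map_sub, ← dist_eq_norm] at h1
  obtain ⟨f, hf⟩ := cauchySeq_tendsto_of_complete hcau
  refine ⟨f, mem_closure_iff_seq_limit.2 ⟨_, fun n => ⟨_, hwE n, rfl⟩, hf⟩,
    fun T U hU hUJ hT => ?_⟩
  refine tendsto_nhds_unique (hf.inner (hU.continuousAt.tendsto.comp hf)) ?_
  have h1 (n) : inner ℂ (J (w n)) ((U ∘ fun n => J (w n)) n) = inner ℂ (y n) (T (y n)) := by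
    rw [Function.comp_apply, hUJ, ← hSJ, ← hwy, ← mul_apply_eq_comp, ← mul_apply_eq_comp,
      (hSc T hT).eq]
  simp only [h1]
  exact hyv.inner ((T.continuous.tendsto v).comp hyv)

end Polar

/-! ### Coefficients of a compact group inside its regular representation -/

section CompactGroup

variable {K H : Type*} [Group K] [TopologicalSpace K] [IsTopologicalGroup K] [CompactSpace K]
  [MeasurableSpace K] [BorelSpace K] [NormedAddCommGroup H] [InnerProductSpace ℂ H]
  [CompleteSpace H]

/-- A diagonal matrix coefficient of a unitary representation of a compact group `K` is a matrix
coefficient of the regular representation; it is a matrix coefficient of a real function if it is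
real. -/
theorem exists_regular_coefficient {m : Measure K} [IsProbabilityMeasure m] [m.IsHaarMeasure]
    {τ : K → H →L[ℂ] H} (hmul : ∀ k k', τ (k * k') = τ k * τ k') (hstar : ∀ k, star (τ k) = τ k⁻¹)
    (hc : ∀ x y, Continuous fun k => inner ℂ x (τ k y)) {v : H} (hv : τ 1 v = v) :
    ∃ f : Lp ℂ 2 m, (∀ k, inner ℂ v (τ k v) = ∫ x, f (k⁻¹ * x) * conj (f x) ∂m) ∧
      ((∀ k, (inner ℂ v (τ k v)).im = 0) → ∀ᵐ x ∂m, (f x).im = 0) := by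
  have hadj (k x y) : inner ℂ (τ k x) y = inner ℂ x (τ k⁻¹ y) := by
    rw [← hstar, ContinuousLinearMap.star_eq_adjoint, ContinuousLinearMap.adjoint_inner_right]
  have hτv (k) : ‖τ k v‖ = ‖v‖ := by
    have h : inner ℂ (τ k v) (τ k v) = inner ℂ v v := by
      rw [hadj, ← mul_apply_eq_comp, ← hmul, inv_mul_cancel, hv]
    rw [@norm_eq_sqrt_re_inner ℂ, h, ← @norm_eq_sqrt_re_inner ℂ]
  have hc' (w) : Continuous fun k => inner ℂ (τ k v) w := by
    have : (fun k => inner ℂ (τ k v) w) = fun k => conj (inner ℂ w (τ k v)) :=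
      funext fun k => (inner_conj_symm _ _).symm
    rw [this]
    exact Complex.continuous_conj.comp (hc w v)
  let J₀ : H →L[ℂ] C(K, ℂ) := LinearMap.mkContinuous
    { toFun w := ⟨_, hc' w⟩
      map_add' w w' := by ext k; simp
      map_smul' c w := by ext k; simp } ‖v‖ fun w =>
    (ContinuousMap.norm_le _ (by positivity)).2 fun k => by
      rw [← hτv k]
      exact norm_inner_le_norm (τ k v) w
  -- The coefficient map w ↦ ⟨w, τ k v⟩ intertwines τ with left translation. It is not isometric, so
  -- its polar part is used.
  let J : H →L[ℂ] Lp ℂ 2 m := ContinuousMap.toLp 2 m ℂ ∘L J₀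
  have hJ (w) : J w =ᵐ[m] fun k => inner ℂ (τ k v) w := ContinuousMap.coeFn_toLp m (J₀ w)
  have hJJ (x y) : inner ℂ (J x) (J y) = ∫ k, inner ℂ (τ k v) y * conj (inner ℂ (τ k v) x) ∂m :=
    ContinuousMap.inner_toLp m (J₀ x) (J₀ y)
  have hA (x y) : inner ℂ x ((ContinuousLinearMap.adjoint J ∘L J) y) =
      ∫ k, inner ℂ (τ k v) y * conj (inner ℂ (τ k v) x) ∂m := by
    rw [← hJJ, ContinuousLinearMap.comp_apply, ContinuousLinearMap.adjoint_inner_right]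
  have hcomm (k) : Commute (ContinuousLinearMap.adjoint J ∘L J) (τ k) := by
    have hinv (s z) : inner ℂ (τ (k * s) v) (τ k z) = inner ℂ (τ s v) z := by
      conv_rhs => rw [← inv_mul_cancel_left k s, hmul, mul_apply_eq_comp, hadj, inv_inv]
    refine ContinuousLinearMap.ext fun y => ext_inner_left ℂ fun x => ?_
    have hx : inner ℂ x (τ k ((ContinuousLinearMap.adjoint J ∘L J) y)) =
        inner ℂ (τ k⁻¹ x) ((ContinuousLinearMap.adjoint J ∘L J) y) := by rw [hadj, inv_inv]
    rw [mul_apply_eq_comp, mul_apply_eq_comp, hx, hA, hA, ← integral_mul_left_eq_self _ k]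
    refine integral_congr_ae (ae_of_all _ fun s => ?_)
    dsimp only
    rw [hinv, hmul k s, mul_apply_eq_comp, hadj k]
  -- The coefficient function is continuous and vanishes almost everywhere, hence everywhere; its
  -- value at k = 1 is the claim.
  have h0 (w) (hw : J w = 0) : inner ℂ w v = 0 := by
    have : J₀ w = 0 := ContinuousMap.toLp_injective (p := 2) (𝕜 := ℂ) m (by rw [map_zero]; exact hw)
    have : inner ℂ (τ 1 v) w = 0 := congrArg (fun f : C(K, ℂ) => f 1) this
    rw [← inner_conj_symm, ← hv, this, map_zero]
  have hU (k) (w) : DomMulAct.mk k⁻¹ • J w = J (τ k w) := by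
    refine Lp.ext ?_
    filter_upwards [DomMulAct.smul_Lp_ae_eq (DomMulAct.mk k⁻¹) (J w), hJ (τ k w),
      (measurePreserving_mul_left m k⁻¹).quasiMeasurePreserving.ae (hJ w)] with x h1 h2 h3
    rw [h1, h2]
    refine h3.trans ?_
    rw [hmul, mul_apply_eq_comp, hadj, inv_inv]
  -- Vectors with real coefficient function. The condition is guarded by reality of the diagonal
  -- coefficient, so E is all of H otherwise and one f serves both claims.
  let E : Submodule ℝ H := {
    carrier := {w | (∀ k, (inner ℂ v (τ k v)).im = 0) → ∀ k, (inner ℂ (τ k v) w).im = 0}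
    add_mem' := fun {a b} ha hb h k => by
      rw [inner_add_right, Complex.add_im, ha h k, hb h k, add_zero]
    zero_mem' := fun h k => by simp
    smul_mem' := fun c a ha h k => by
      rw [RCLike.real_smul_eq_coe_smul (K := ℂ), inner_smul_right]
      simp [ha h k] }
  have hE : IsClosed (E : Set H) := by
    have : (E : Set H) = ⋂ (_ : ∀ k, (inner ℂ v (τ k v)).im = 0), ⋂ k,
        {w | (inner ℂ (τ k v) w).im = 0} := by
      ext w
      simp only [Set.mem_iInter]
      rfl
    rw [this]
    exact isClosed_iInter fun _ => isClosed_iInter fun k => isClosed_eq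
      (Complex.continuous_im.comp (continuous_const.inner continuous_id)) continuous_const
  have hJE : ∀ x ∈ E, (ContinuousLinearMap.adjoint J ∘L J) x ∈ E := fun x hx h k => by
    have h1 (s) : inner ℂ (τ s v) x * conj (inner ℂ (τ s v) (τ k v)) =
        ((inner ℂ (τ s v) x).re * (inner ℂ v (τ (s⁻¹ * k) v)).re : ℝ) := by
      rw [hadj s v (τ k v), ← mul_apply_eq_comp, ← hmul]
      apply Complex.ext
      · rw [Complex.mul_re, Complex.conj_re, Complex.conj_im, hx h s, Complex.ofReal_re]
        ring
      · rw [Complex.mul_im, Complex.conj_re, Complex.conj_im, hx h s, h, Complex.ofReal_im]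
        ring
    rw [hA]
    simp only [h1]
    rw [integral_complex_ofReal, Complex.ofReal_im]
  have hvE : v ∈ E := fun h k => by
    rw [hadj, h]
  obtain ⟨f, hf, hfv⟩ := exists_mem_closure_image_inner_eq J hE hJE hvE h0
  refine ⟨f, fun k => ?_, fun h => ?_⟩
  · rw [← hfv (τ k) (DomMulAct.mk k⁻¹ • ·) (isometry_smul _ _).continuous (hU k) (hcomm k),
      L2.inner_def]
    refine integral_congr_ae ?_
    filter_upwards [DomMulAct.smul_Lp_ae_eq (DomMulAct.mk k⁻¹) f] with x hx
    rw [hx, RCLike.inner_apply]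
    rfl
  · obtain ⟨w, hw, hwf⟩ := mem_closure_iff_seq_limit.1 hf
    choose y hy hyw using hw
    -- L² convergence yields an almost everywhere convergent subsequence, through which realness
    -- passes to f.
    obtain ⟨ns, -, hns⟩ := (tendstoInMeasure_of_tendsto_Lp hwf).exists_seq_tendsto_ae
    filter_upwards [hns, ae_all_iff.2 fun n => hJ (y n)] with x hx hxy
    refine tendsto_nhds_unique (((Complex.continuous_im.tendsto _).comp hx).congr fun n => ?_)
      tendsto_const_nhds
    rw [Function.comp_apply, ← hyw, hxy]
    exact hy _ h x

end CompactGroup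

/-! ### Assembling the system and the function -/

theorem integral_add_four {X : Type*} [MeasurableSpace X] {μ : Measure X} {f₁ f₂ f₃ f₄ : X → ℂ}
    (h₁ : Integrable f₁ μ) (h₂ : Integrable f₂ μ) (h₃ : Integrable f₃ μ) (h₄ : Integrable f₄ μ) :
    ∫ x, f₁ x + f₂ x + f₃ x + f₄ x ∂μ =
      ∫ x, f₁ x ∂μ + ∫ x, f₂ x ∂μ + ∫ x, f₃ x ∂μ + ∫ x, f₄ x ∂μ := by
  rw [← integral_add h₁ h₂, ← integral_add (f := fun x => f₁ x + f₂ x) (h₁.add h₂) h₃,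
    ← integral_add (f := fun x => f₁ x + f₂ x + f₃ x) ((h₁.add h₂).add h₃) h₄]

/-- A complex random variable with prescribed covariance, as a linear combination of two real
coordinates. -/
theorem exists_integral_mul_conj_eq {G H : Type*} [Group G] [NormedAddCommGroup H]
    [InnerProductSpace ℂ H] {ρ : G →* (H →L[ℂ] H)} {u : H} {γ : Measure (G ⊕ G → ℝ)}
    (hm : ∀ a, MemLp (fun x => x a) 2 γ)
    (hγ : ∀ a b, ∫ x, x a * x b ∂γ = (inner ℂ (Sum.elim (fun g => ρ g u)
      (fun g => ρ g (Complex.I • u)) a) (Sum.elim (fun g => ρ g u)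
      (fun g => ρ g (Complex.I • u)) b)).re) :
    ∃ a b : ℂ, (∀ g, ∫ x, (a * x (.inl g) + b * x (.inr g)) *
        conj (a * x (.inl 1) + b * x (.inr 1)) ∂γ = inner ℂ u (ρ g u)) ∧
      ((∀ g, (inner ℂ u (ρ g u)).im = 0) → a.im = 0 ∧ b = 0) := by
  have hint (a b) : Integrable (fun x : G ⊕ G → ℝ => ((x a * x b : ℝ) : ℂ)) γ :=
    ((hm a).integrable_mul (hm b)).ofReal
  have key (a b : ℂ) (g : G) : ∫ x, (a * x (.inl g) + b * x (.inr g)) *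
      conj (a * x (.inl 1) + b * x (.inr 1)) ∂γ =
      (a * conj a + b * conj b) * (inner ℂ u (ρ g u)).re +
        (a * conj b - b * conj a) * (inner ℂ u (ρ g u)).im := by
    have h1 (x : G ⊕ G → ℝ) : (a * x (.inl g) + b * x (.inr g)) *
        conj (a * x (.inl 1) + b * x (.inr 1)) = a * conj a * (x (.inl g) * x (.inl 1) : ℝ) +
          a * conj b * (x (.inl g) * x (.inr 1) : ℝ) + b * conj a * (x (.inr g) * x (.inl 1) : ℝ) +
          b * conj b * (x (.inr g) * x (.inr 1) : ℝ) := by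
      simp only [map_add, map_mul, Complex.conj_ofReal, Complex.ofReal_mul]
      ring
    simp only [h1]
    rw [integral_add_four ((hint _ _).const_mul _) ((hint _ _).const_mul _)
      ((hint _ _).const_mul _) ((hint _ _).const_mul _)]
    simp only [integral_const_mul, integral_complex_ofReal, hγ]
    simp only [Sum.elim_inl, Sum.elim_inr, map_smul, inner_smul_left, inner_smul_right, map_one,
      one_apply_eq_self, Complex.conj_I]
    rw [← inner_conj_symm (ρ g u) u]
    generalize inner ℂ u (ρ g u) = z
    simp
    ring
  by_cases h : ∀ g, (inner ℂ u (ρ g u)).im = 0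
  · refine ⟨1, 0, fun g => ?_, by simp⟩
    rw [key]
    apply Complex.ext <;> simp [h g]
  -- With a = s, b = -is and s² = 1/2, the coefficients in `key` are aā + bb̄ = 1 and ab̄ - bā = i,
  -- which restores the full complex value.
  · have hs : ((√(1 / 2) : ℝ) : ℂ) * ((√(1 / 2) : ℝ) : ℂ) = 1 / 2 := by
      rw [← Complex.ofReal_mul, Real.mul_self_sqrt (by norm_num)]; norm_num
    set s : ℝ := √(1 / 2)
    refine ⟨s, -Complex.I * s, fun g => ?_, fun h' => absurd h' h⟩
    rw [key]
    simp only [map_mul, Complex.conj_ofReal, map_neg, Complex.conj_I]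
    conv_rhs => rw [← Complex.re_add_im (inner ℂ u (ρ g u))]
    linear_combination (2 * ((inner ℂ u (ρ g u)).re : ℂ) +
      2 * Complex.I * (inner ℂ u (ρ g u)).im) * hs - s * s * (inner ℂ u (ρ g u)).re * Complex.I_sq

/-- Each cross term factors over the product and contains the mean of F or F'. The functions on the
second factor need not be centered. -/
theorem integral_add_mul_conj_prod {X Y : Type*} [MeasurableSpace X] [MeasurableSpace Y]
    {γ : Measure X} {m : Measure Y} [IsProbabilityMeasure γ] [IsProbabilityMeasure m]
    {F F' : X → ℂ} {C C' : Y → ℂ} (hF : MemLp F 2 γ) (hF' : MemLp F' 2 γ) (hC : MemLp C 2 m)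
    (hC' : MemLp C' 2 m) (h0 : ∫ x, F x ∂γ = 0) (h0' : ∫ x, F' x ∂γ = 0) :
    ∫ p, (F' p.1 + C' p.2) * conj (F p.1 + C p.2) ∂(γ.prod m) =
      ∫ x, F' x * conj (F x) ∂γ + ∫ y, C' y * conj (C y) ∂m := by
  have h1 (p : X × Y) : (F' p.1 + C' p.2) * conj (F p.1 + C p.2) = F' p.1 * conj (F p.1) +
      C' p.2 * conj (C p.2) + F' p.1 * conj (C p.2) + conj (F p.1) * C' p.2 := by
    rw [map_add]; ring
  have i1 : Integrable (fun p : X × Y => F' p.1 * conj (F p.1)) (γ.prod m) :=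
    (hF'.integrable_mul hF.star).comp_fst m
  have i2 : Integrable (fun p : X × Y => C' p.2 * conj (C p.2)) (γ.prod m) :=
    (hC'.integrable_mul hC.star).comp_snd γ
  have i3 : Integrable (fun p : X × Y => F' p.1 * conj (C p.2)) (γ.prod m) :=
    (hF'.integrable one_le_two).mul_prod (hC.star.integrable one_le_two)
  have i4 : Integrable (fun p : X × Y => conj (F p.1) * C' p.2) (γ.prod m) :=
    (hF.star.integrable one_le_two).mul_prod (hC'.integrable one_le_two)
  have h0c : ∫ x, conj (F x) ∂γ = 0 := by rw [integral_conj, h0, map_zero]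
  simp only [h1]
  rw [integral_add_four i1 i2 i3 i4,
    integral_prod_mul F' (fun y => conj (C y)), integral_prod_mul (fun x => conj (F x)) C',
    h0c, h0', integral_fun_fst (fun x => F' x * conj (F x)),
    integral_fun_snd (fun x => C' x * conj (C x))]
  simp

theorem MeasurePreservingSystem.inner_koopman_toLp {G : Type u} [Group G] [TopologicalSpace G]
    (S : MeasurePreservingSystem.{u, v} G) {f : S.X → ℂ} (hf : MemLp f 2 S.μ) (g : G) :
    inner ℂ (hf.toLp f) (S.koopman g (hf.toLp f)) = ∫ x, f (g⁻¹ • x) * conj (f x) ∂S.μ := by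
  rw [L2.inner_def, MeasurePreservingSystem.koopman, DomMulAct.mk_smul_toLp]
  refine integral_congr_ae ?_
  filter_upwards [hf.coeFn_toLp, MemLp.coeFn_toLp
    (hf.comp_measurePreserving (measurePreserving_smul g⁻¹ S.μ))] with x h1 h2
  rw [h1]
  exact (congrArg (inner ℂ (f x)) h2).trans (RCLike.inner_apply _ _)

section ProductSystem

variable {G : Type u} [Group G] [TopologicalSpace G] [IsTopologicalGroup G] {ι K : Type u}
  [MulAction G ι] [Group K] [TopologicalSpace K] [IsTopologicalGroup K] [CompactSpace K]
  [MeasurableSpace K] [BorelSpace K]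
  {E : Type*} [NormedAddCommGroup E] [InnerProductSpace ℝ E]
  {γ : Measure (ι → ℝ)} [IsProbabilityMeasure γ] {j : ι → E}

/-- The action of `G` on `(ι → ℝ) × K` by `shiftTranslate`. -/
@[reducible] def shiftTranslateAction (κ : G →* K) : MulAction G ((ι → ℝ) × K) where
  smul := shiftTranslate κ
  one_smul p := by
    change shiftTranslate κ 1 p = p
    simp [shiftTranslate]
  mul_smul g h p := by
    change shiftTranslate κ (g * h) p = shiftTranslate κ g (shiftTranslate κ h p)
    simp [shiftTranslate, mul_smul, mul_assoc]

/-- The product of a Gaussian system and a translation of a compact group. -/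
noncomputable def shiftTranslateSystem (h : HasGaussianCov γ j)
    (hj : ∀ (g : G) a b, inner ℝ (j (g • a)) (j (g • b)) = inner ℝ (j a) (j b))
    (hjc : ∀ a, Continuous fun g : G => j (g • a)) {κ : G →* K} (hκ : Continuous κ)
    (m : Measure K) [IsProbabilityMeasure m] [m.IsHaarMeasure] [m.Regular] :
    MeasurePreservingSystem.{u, u} G :=
  letI := shiftTranslateAction (ι := ι) κ
  { X := (ι → ℝ) × K
    μ := γ.prod m
    measurableConstSMul := ⟨fun g => (measurePreserving_shiftTranslate (m := m) h hj κ g).measurable⟩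
    smulInvariantMeasure := ⟨fun g _ hs =>
      (measurePreserving_shiftTranslate (m := m) h hj κ g).measure_preimage hs.nullMeasurableSet⟩
    tendsto_measure_symmDiff := fun A hA => by
      have h1 := (tendsto_measure_symmDiff_shiftTranslate (m := m) h hj hjc hκ hA).comp
        (continuous_inv.tendsto' (1 : G) 1 inv_one)
      refine h1.congr fun g => ?_
      rw [← Set.preimage_smul_inv]
      rfl }

theorem isErgodic_shiftTranslateSystem (h : HasGaussianCov γ j)
    (hj : ∀ (g : G) a b, inner ℝ (j (g • a)) (j (g • b)) = inner ℝ (j a) (j b))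
    (hjc : ∀ a, Continuous fun g : G => j (g • a)) {κ : G →* K} (hκ : Continuous κ)
    {l : Filter G} [l.NeBot] (hl : ∀ a b, Tendsto (fun g => inner ℝ (j (g • a)) (j b)) l (𝓝 0))
    (hκd : DenseRange κ) (m : Measure K) [IsProbabilityMeasure m] [m.IsHaarMeasure] [m.Regular] :
    (shiftTranslateSystem h hj hjc hκ m).IsErgodic :=
  ⟨fun hA hinv => ergodic_shiftTranslate h hj hl hκd hA hinv⟩

end ProductSystem

theorem exists_shiftTranslateSystem {G : Type u} [Group G] [TopologicalSpace G]
    [IsTopologicalGroup G] {φ : G → ℂ} (hφ : Continuous φ) (hpd : IsPositiveDefiniteFun φ) :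
    ∃ S : MeasurePreservingSystem.{u, u} G, S.IsErgodic ∧
      ∃ f : Lp ℂ 2 S.μ, (∀ g : G, φ g = inner ℂ f (S.koopman g f)) ∧
        ((∀ g : G, (φ g).im = 0) → ∀ᵐ x ∂S.μ, (f x).im = 0) := by
  obtain ⟨H, _, _, _, ρ, v, hρ, hφρ, hspan⟩ := exists_unitary_representation hpd
  have hρc (x) : Continuous fun g => ρ g x := continuous_unitary_representation hρ hspan
    (hφ.congr hφρ) x
  obtain ⟨K, _, _, _, _, _, κ, τ, P, l, _, hκd, hκ, hτmul, hτstar, hτ1, hτκ, hPρ, hτc, hl⟩ :=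
    exists_compact_part hρ hρc
  have hPP : P * P = P := by rw [← hτ1, ← hτmul, one_mul]
  have hPs (x y) : inner ℂ (P x) y = inner ℂ x (P y) := by
    rw [← ContinuousLinearMap.adjoint_inner_right, ← ContinuousLinearMap.star_eq_adjoint,
      ← hτ1, hτstar, inv_one]
  have hPPx (x) : P (P x) = P x := congrArg (fun T : H →L[ℂ] H => T x) hPP
  have hPρx (g x) : P (ρ g x) = ρ g (P x) := congrArg (fun T : H →L[ℂ] H => T x) (hPρ g)
  have hρadj (g x y) : inner ℂ (ρ g x) y = inner ℂ x (ρ g⁻¹ y) := by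
    rw [← hρ, ContinuousLinearMap.star_eq_adjoint, ContinuousLinearMap.adjoint_inner_right]
  have hρmul (g h x) : ρ (g * h) x = ρ g (ρ h x) := by rw [map_mul]; rfl
  set u : H := v - P v with hu
  have hPu : P u = 0 := by rw [hu, map_sub, hPPx, sub_self]
  have hsplit (g) : φ g = inner ℂ u (ρ g u) + inner ℂ (P v) (ρ g (P v)) := by
    have hv : v = u + P v := by rw [hu, sub_add_cancel]
    have h1 : inner ℂ u (ρ g (P v)) = 0 := by rw [← hPρx, ← hPs, hPu, inner_zero_left]
    have h2 : inner ℂ (P v) (ρ g u) = 0 := by rw [hPs, hPρx, hPu, map_zero, inner_zero_right]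
    rw [hφρ]
    calc inner ℂ v (ρ g v) = inner ℂ (u + P v) (ρ g (u + P v)) := by rw [← hv]
      _ = _ := by
        rw [map_add, inner_add_left, inner_add_right, inner_add_right, h1, h2]
        ring
  have hτPv (g) : τ (κ g) (P v) = ρ g (P v) := by
    rw [hτκ, mul_apply_eq_comp, hPPx]
  -- On the dense image of κ, the coefficient of Pv at κ g is the limit of φ(g h) as h runs along l,
  -- hence real; continuity extends this to K.
  have hcreal (h : ∀ g, (φ g).im = 0) (k) : (inner ℂ (P v) (τ k (P v))).im = 0 := by
    have hclosed : IsClosed {k | (inner ℂ (P v) (τ k (P v))).im = 0} :=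
      isClosed_eq (Complex.continuous_im.comp (hτc _ _)) continuous_const
    refine hκd.induction_on (p := fun k => (inner ℂ (P v) (τ k (P v))).im = 0) k hclosed fun g => ?_
    rw [hτPv, hPs, hPρx, hPPx, ← inv_inv g, ← hρadj]
    have h1 := (Complex.continuous_im.tendsto _).comp (hl (ρ g⁻¹ v) v)
    refine tendsto_nhds_unique (h1.congr fun h' => ?_) tendsto_const_nhds
    rw [Function.comp_apply, hρadj, ← hρmul, inv_inv, ← hφρ, h]
  let _ : MeasurableSpace K := borel K
  have : BorelSpace K := ⟨rfl⟩
  let m : Measure K := Measure.haarMeasure ⊤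
  have : IsProbabilityMeasure m := ⟨Measure.haarMeasure_self⟩
  let _ : InnerProductSpace ℝ H := InnerProductSpace.complexToReal
  -- A real Gaussian process records only Re⟨·, ·⟩; the second copy, built from iu, supplies the
  -- imaginary part.
  let j : G ⊕ G → H := Sum.elim (fun g => ρ g u) (fun g => ρ g (Complex.I • u))
  have hj_smul (g : G) (a) : j (g • a) = ρ g (j a) := by
    rcases a with a | a <;> exact hρmul _ _ _
  have hPj (a) : P (j a) = 0 := by
    rcases a with a | a <;> simp [j, hPρx, hPu]
  obtain ⟨γ, _, hγ⟩ := exists_gaussian_measure j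
  have hγ : HasGaussianCov γ j := hγ
  have hj (g : G) (a b) : inner ℝ (j (g • a)) (j (g • b)) = inner ℝ (j a) (j b) := by
    rw [hj_smul, hj_smul, real_inner_eq_re_inner ℂ, hρadj, ← hρmul, inv_mul_cancel, map_one,
      real_inner_eq_re_inner ℂ]
    rfl
  have hjc (a) : Continuous fun g : G => j (g • a) := by
    simp only [hj_smul]
    exact hρc _
  -- All the vectors j a lie in the kernel of P, the weak limit of ρ along l; this is the mixing
  -- hypothesis.
  have hjl (a b) : Tendsto (fun g => inner ℝ (j (g • a)) (j b)) l (𝓝 0) := by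
    have h1 := (Complex.continuous_re.tendsto _).comp (hl (j b) (j a))
    rw [hPj, inner_zero_right, Complex.zero_re] at h1
    refine h1.congr fun g => ?_
    rw [Function.comp_apply, hj_smul, real_inner_comm, real_inner_eq_re_inner ℂ]
    rfl
  obtain ⟨a, b, hab, hab_real⟩ := exists_integral_mul_conj_eq hγ.memLp fun a b => hγ.integral_mul a b
  obtain ⟨c, hc, hc_real⟩ := exists_regular_coefficient (m := m) hτmul hτstar hτc
    (v := P v) (by rw [hτ1, hPPx])
  let F (g : G) (x : G ⊕ G → ℝ) : ℂ := a * x (.inl g) + b * x (.inr g)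
  have hF (g) : MemLp (F g) 2 γ :=
    ((hγ.memLp _).ofReal.const_mul a).add ((hγ.memLp _).ofReal.const_mul b)
  have hF0 (g) : ∫ x, F g x ∂γ = 0 := by
    have hi (a) : Integrable (fun x : G ⊕ G → ℝ => (x a : ℂ)) γ :=
      ((hγ.memLp a).integrable one_le_two).ofReal
    rw [integral_add ((hi _).const_mul a) ((hi _).const_mul b), integral_const_mul,
      integral_const_mul, integral_complex_ofReal, integral_complex_ofReal, hγ.integral,
      hγ.integral]
    simp
  have hC (k : K) : MemLp (fun x => c (k⁻¹ * x)) 2 m :=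
    (Lp.memLp c).comp_measurePreserving (measurePreserving_mul_left m k⁻¹)
  let S := shiftTranslateSystem hγ hj hjc hκ m
  let f : S.X → ℂ := fun p : (G ⊕ G → ℝ) × K => F 1 p.1 + c p.2
  have hf : MemLp f 2 S.μ := ((hF 1).comp_fst m).add ((Lp.memLp c).comp_snd γ)
  refine ⟨S, isErgodic_shiftTranslateSystem hγ hj hjc hκ hjl hκd m, hf.toLp f, fun g => ?_,
    fun h => ?_⟩
  · have hcg := hc (κ g)
    rw [hτPv] at hcg
    rw [S.inner_koopman_toLp, hsplit, ← hab, hcg, ← integral_add_mul_conj_prod (hF 1) (hF g)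
      (Lp.memLp c) (hC (κ g)) (hF0 1) (hF0 g)]
    refine integral_congr_ae (ae_of_all _ fun p => congrArg (· * conj (f p)) ?_)
    change _ = F 1 (fun a => p.1 (g⁻¹⁻¹ • a)) + c (κ g⁻¹ * p.2)
    simp [F]
  -- The coefficient at u is the difference of φ and the coefficient at Pv, both real.
  · have h1 := hab_real fun g => by
      have h2 := hcreal h (κ g)
      rw [hτPv] at h2
      have h3 := h g
      rwa [hsplit, Complex.add_im, h2, add_zero] at h3
    have hc0 : ∀ᵐ p ∂S.μ, (f p).im = 0 := by
      filter_upwards [Measure.quasiMeasurePreserving_snd.ae (hc_real (hcreal h))] with p h3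
      have h4 : (c p.2).im = 0 := h3
      simp [f, F, h1.1, h1.2, h4]
    filter_upwards [hf.coeFn_toLp, hc0] with p h2 h3
    rw [h2, h3]

theorem mainTheorem4 {G : Type u} [Group G] [TopologicalSpace G] [IsTopologicalGroup G]
    [LocallyCompactSpace G] [SecondCountableTopology G]
    (φ : G → ℂ) (hφ : Continuous φ) (hpd : IsPositiveDefiniteFun φ) :
    ∃ S : MeasurePreservingSystem.{u, u} G, S.IsErgodic ∧
      ∃ f : Lp ℂ 2 S.μ, (∀ g : G, φ g = inner ℂ f (S.koopman g f)) ∧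
        ((∀ g : G, (φ g).im = 0) → ∀ᵐ x ∂S.μ, (f x).im = 0) := by
  exact exists_shiftTranslateSystem hφ hpd
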